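/- **Corollary.** Let the ambient transmitters $\Phi$ be located at the points $\mathbf x_a$ of a homogeneous Poisson point process of spatial density $\zeta_A>0$ on $\mathbb R^2$. Each transmitter is active independently with probability $l_A\in(0,1]$ (the transmission load); let $\mathcal A$ be the set of active ones. The ambient fading gains $h_a$ are i.i.d. $\mathrm{Exp}(1)$ (Rayleigh fading), the gain $h_{\mathrm{S},\mathrm{D}}$ of the link from the hybrid transmitter, located at $\mathbf x_{\mathrm S}$, to its receiver, located at $\mathbf x_{\mathrm D}$, $d=\|\mathbf x_{\mathrm S}-\mathbf x_{\mathrm D}\|>0$, is exponential with rate $\lambda>0$, and locations, activity indicators, ambient gains and link gain are independent. The path-loss exponent is $\mu=4$. Let $$P_I=P_A\sum_{a\in\mathcal A}h_a\|\mathbf x_a-\mathbf x_{\mathrm S}\|^{-4},\qquad P_A>0,$$ be the incident power at the hybrid transmitter. Let $0<\beta\le1$, $0<\varrho<1$, $0<\omega<1$, $0<\delta\le 1$, $\sigma,\rho_{\mathrm B},\rho_{\mathrm H}>0$, $\tau_{\mathrm B}\ge0$; put $P_E^{\mathrm B}=\beta\varrho P_I$ and $P_E^{\mathrm H}=\omega\beta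 P_I$ (energy harvesting rates in ambient backscattering and in harvest-then-transmit mode), and let $\nu_{\mathrm B}=\delta P_I(1-\varrho)h_{\mathrm{S},\mathrm{D}}\,d^{-4}/\sigma^2$ if $P_E^{\mathrm B}>\rho_{\mathrm B}$ and $\nu_{\mathrm B}=0$ otherwise (the signal-to-noise ratio of the backscatter at the receiver). For a protocol that selects backscattering with probability $\mathcal B$, the energy outage probability is defined as $$\mathcal O=\mathcal B\,\mathbb P[P_E^{\mathrm B}\le\rho_{\mathrm B}]+(1-\mathcal B)\,\mathbb P[P_E^{\mathrm H}\le\rho_{\mathrm H}],$$ where $\mathcal B=\mathbb P[P_E^{\mathrm H}\le\rho_{\mathrm H}]$ for the power threshold-based protocol (PTP) and $\mathcal B=\mathbb P[\nu_{\mathrm B}>\tau_{\mathrm B},\,P_E^{\mathrm B}>\rho_{\mathrm B}]$ for the SNR threshold-based protocol (STP). Write $\zeta=l_A\zeta_A$ (so $\zeta=\zeta_A$ when all transmitters are active, $l_A=1$). Then the series $P_I$ converges almost surely; its law is concentrated on $(0,\infty)$ with density $$f_{P_I}(\rho)=\frac14\Big(\frac{\pi}{\rho}\Big)^{3/2}\zeta\sqrt{P_A}\,\exp\Big(-\frac{\pi^4\zeta^2P_A}{16\rho}\Big),\qquad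 \rho>0,$$ and its distribution function is $$F_{P_I}(\rho)=\mathrm{erfc}\Big(\frac{\zeta\sqrt{P_A}\,\pi^2}{4\sqrt\rho}\Big),\qquad \rho>0,\qquad \mathrm{erfc}(x)=\frac2{\sqrt\pi}\int_x^\infty e^{-t^2}\,dt.$$ With these $f_{P_I}$ and $F_{P_I}$, the energy outage probabilities under PTP and STP are $$\mathcal O_{\mathrm{PTP}}=F_{P_I}\Big(\frac{\rho_{\mathrm H}}{\omega\beta}\Big)\Big(F_{P_I}\Big(\frac{\rho_{\mathrm B}}{\beta\varrho}\Big)-F_{P_I}\Big(\frac{\rho_{\mathrm H}}{\omega\beta}\Big)+1\Big),$$ $$\mathcal O_{\mathrm{STP}}=\int_{\rho_{\mathrm B}/(\beta\varrho)}^\infty\exp\Big(-\frac{\lambda\tau_{\mathrm B}d^4\sigma^2}{\delta\rho(1-\varrho)}\Big)f_{P_I}(\rho)\,d\rho\;\Big(F_{P_I}\Big(\frac{\rho_{\mathrm B}}{\beta\varrho}\Big)-F_{P_I}\Big(\frac{\rho_{\mathrm H}}{\omega\beta}\Big)\Big)+F_{P_I}\Big(\frac{\rho_{\mathrm H}}{\omega\beta}\Big),$$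 where the integral converges absolutely. -/

import Mathlib

open MeasureTheory ProbabilityTheory Set
open scoped ENNReal NNReal

noncomputable section

namespace HybridD2D

/-- The Euclidean plane. -/
abbrev Plane : Type := EuclideanSpace ℝ (Fin 2)

variable {Ω : Type*} [MeasurableSpace Ω]

/-! ### Poisson point processes -/

/-- The number of points of the random collection `X 0, X 1, …` that lie in `B`. -/
def count {E : Type*} (X : ℕ → Ω → E) (B : Set E) (w : Ω) : ℕ∞ :=
  {a : ℕ | X a w ∈ B}.encard

/-- The random points `X 0, X 1, …` form a Poisson point process with intensity measure `Λ`: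
the number of points in a measurable set `B` of finite intensity is Poisson with mean `Λ B`, and
the numbers of points in finitely many disjoint measurable sets are independent. (The points of
a process of infinite total intensity, such as a homogeneous one on the plane, are almost surely
infinitely many, hence the enumeration by `ℕ`.) -/
structure IsPoissonProcess {E : Type*} [MeasurableSpace E] (X : ℕ → Ω → E) (Λ : Measure E)
    (Pr : Measure Ω) : Prop where
  measurable : ∀ a, Measurable (X a)
  count_law : ∀ B : Set E, MeasurableSet B → Λ B ≠ ∞ →
    HasLaw (count X B) ((poissonMeasure (Λ B).toNNReal).map (fun k : ℕ => (k : ℕ∞))) Pr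
  count_indep : ∀ (m : ℕ) (B : Fin m → Set E), (∀ i, MeasurableSet (B i)) →
    (∀ i j, i ≠ j → Disjoint (B i) (B j)) → iIndepFun (fun i => count X (B i)) Pr

/-! ### The network -/

/-- The probabilistic model. The locations `X a` of the ambient transmitters form a homogeneous
Poisson point process of spatial density `ζ` on the whole plane; the state indicators `c a` are
i.i.d., transmitter `a` being active with probability `l` (the transmission load); the fading
gains `h a` from the ambient transmitters are i.i.d. exponential of rate `1` (Rayleigh fading of
unit mean); the gain `g` of the link from the hybrid transmitter to its receiver is exponential
of rate `lam`; and locations, indicators, ambient gains and link gain are mutually independent. -/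
structure IsNetwork (X : ℕ → Ω → Plane) (c : ℕ → Ω → Bool) (h : ℕ → Ω → ℝ) (g : Ω → ℝ)
    (ζ l lam : ℝ) (Pr : Measure Ω) : Prop where
  poisson : IsPoissonProcess X (ENNReal.ofReal ζ • (volume : Measure Plane)) Pr
  measurable_c : ∀ a, Measurable (c a)
  load : ∀ a, Pr {w | c a w = true} = ENNReal.ofReal l
  indep_c : iIndepFun c Pr
  measurable_h : ∀ a, Measurable (h a)
  law_h : ∀ a, HasLaw (h a) (expMeasure 1) Pr
  indep_h : iIndepFun h Pr
  measurable_g : Measurable g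
  law_g : HasLaw g (expMeasure lam) Pr
  indep_X : IndepFun (fun w a => X a w) (fun w => ((fun a => c a w), (fun a => h a w), g w)) Pr
  indep_c_hg : IndepFun (fun w a => c a w) (fun w => ((fun a => h a w), g w)) Pr
  indep_h_g : IndepFun (fun w a => h a w) g Pr

/-- The contribution `h_a ‖x_a - x_S‖ ^ (-μ)` of transmitter `a` to the incident power at `xS`,
per unit of transmit power. -/
def receivedGain (μ : ℝ) (xS : Plane) (X : ℕ → Ω → Plane) (h : ℕ → Ω → ℝ) (w : Ω) (a : ℕ) : ℝ :=
  h a w * ‖X a w - xS‖ ^ (-μ)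

/-- The incident power `P_I = P_A ∑ h_a ‖x_a - x_S‖ ^ (-μ)`, summed over the active ambient
transmitters. -/
def incidentPower (PA μ : ℝ) (xS : Plane) (X : ℕ → Ω → Plane) (c : ℕ → Ω → Bool)
    (h : ℕ → Ω → ℝ) (w : Ω) : ℝ :=
  PA * ∑' a : {a : ℕ // c a w = true}, receivedGain μ xS X h w a

/-- Energy harvesting rate in ambient backscattering mode, `β ϱ P_I`. -/
def harvestB (β ϱ : ℝ) (PI : Ω → ℝ) (w : Ω) : ℝ := β * ϱ * PI w

/-- Energy harvesting rate in harvest-then-transmit mode, `ω β P_I`. -/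
def harvestH (ω β : ℝ) (PI : Ω → ℝ) (w : Ω) : ℝ := ω * β * PI w

open Classical in
/-- Power at the hybrid receiver of the backscatter from the hybrid transmitter at distance `d`:
`δ P_I (1 - ϱ) g d ^ (-μ)` if the energy harvested exceeds `ρB`, and `0` otherwise. -/
def backscatterPower (δ β ϱ ρB d μ : ℝ) (PI g : Ω → ℝ) (w : Ω) : ℝ :=
  if ρB < harvestB β ϱ PI w then δ * PI w * (1 - ϱ) * g w * d ^ (-μ) else 0

/-- Signal-to-noise ratio at the hybrid receiver in ambient backscattering mode, for noise of
standard deviation `σ`. -/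
def snrB (δ β ϱ ρB d μ σ : ℝ) (PI g : Ω → ℝ) (w : Ω) : ℝ :=
  backscatterPower δ β ϱ ρB d μ PI g w / σ ^ 2

/-- Probability that the power threshold-based protocol selects backscattering. -/
def selectPTP (ω β ρH : ℝ) (PI : Ω → ℝ) (Pr : Measure Ω) : ℝ :=
  Pr.real {w | harvestH ω β PI w ≤ ρH}

/-- Probability that the SNR threshold-based protocol selects backscattering. -/
def selectSTP (δ β ϱ ρB d μ σ τB : ℝ) (PI g : Ω → ℝ) (Pr : Measure Ω) : ℝ :=
  Pr.real {w | τB < snrB δ β ϱ ρB d μ σ PI g w ∧ ρB < harvestB β ϱ PI w}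

/-- The energy outage probability `B ℙ[P_E^B ≤ ρ_B] + (1 - B) ℙ[P_E^H ≤ ρ_H]` of a protocol that
selects backscattering with probability `B`. -/
def energyOutage (B ω β ϱ ρB ρH : ℝ) (PI : Ω → ℝ) (Pr : Measure Ω) : ℝ :=
  B * Pr.real {w | harvestB β ϱ PI w ≤ ρB} + (1 - B) * Pr.real {w | harvestH ω β PI w ≤ ρH}

/-! ### The explicit law -/

/-- The complementary error function `(2 / √π) ∫_x^∞ exp (-t ^ 2) dt`. -/
def erfc (x : ℝ) : ℝ := 2 / √Real.pi * ∫ t in Ioi x, Real.exp (-t ^ 2)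

/-- The density on `(0, ∞)`. -/
def pdfPI (ζ PA ρ : ℝ) : ℝ :=
  1 / 4 * (Real.pi / ρ) ^ (3 / 2 : ℝ) * ζ * √PA *
    Real.exp (-(Real.pi ^ 4 * ζ ^ 2 * PA / (16 * ρ)))

/-- The distribution function on `(0, ∞)`. -/
def cdfPI (ζ PA ρ : ℝ) : ℝ := erfc (ζ * √PA * Real.pi ^ 2 / (4 * √ρ))

end HybridD2D

end

/-! The incident power is the shot noise of a Poisson process with i.i.d. marks, and it is
identified through its Laplace transform. Everything is summed in `[0, ∞]`, with `negExp ∞ = 0`, so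
no convergence is presupposed.

Given the locations, averaging over states and gains turns the factor of a point of path gain `r`
into `l / (1 + r) + (1 - l) = 1 - l r / (1 + r)`. This lies in `(0, 1]`, hence is `exp (-f)` for
some `f ≥ 0` depending on the location, and the Laplace functional
`IsPoissonProcess.lintegral_negExp_tsum` of the locations alone suffices. For exponent `4` the
resulting integral over the plane is elementary (`lintegral_pathGain`): the transform at `s` is `exp
(-2 k √s)` with `k = levyScale (l * ζ) PA`. The stated density has the same transform, through a
primitive explicit in `erfc` (`hasDerivAt_levyPrimitive`); its case `s = 0` also yields the
distribution function.

Uniqueness needs only integer `s = n`: these values are the moments of `exp (-S)`, which lives on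
`[0, 1]` (`hasLaw_toReal_of_laplace`). As `exp (-ρ)` never vanishes, equality of laws also forces `S
< ∞` almost surely, which is the convergence of the series. The selection probability of STP then
follows by Fubini from the independence of the link gain (`measure_lt_and_lt`). -/

namespace HybridD2D

open Filter Topology

noncomputable section

/-! ### The exponential `x ↦ exp (-x)` on `[0, ∞]` -/

/-- The function `x ↦ exp (-x)` on `[0, ∞]`, with value `0` at `∞`. -/
def negExp (x : ℝ≥0∞) : ℝ≥0∞ := (EReal.exp x)⁻¹

@[simp] lemma negExp_zero : negExp 0 = 1 := by simp [negExp]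

@[simp] lemma negExp_top : negExp ∞ = 0 := by simp [negExp]

lemma negExp_ofReal {r : ℝ} (hr : 0 ≤ r) :
    negExp (ENNReal.ofReal r) = ENNReal.ofReal (Real.exp (-r)) := by
  rw [negExp, EReal.coe_ennreal_ofReal, max_eq_left hr, EReal.exp_coe,
    ← ENNReal.ofReal_inv_of_pos (Real.exp_pos r), Real.exp_neg]

lemma negExp_add (x y : ℝ≥0∞) : negExp (x + y) = negExp x * negExp y := by
  rw [negExp, EReal.coe_ennreal_add, EReal.exp_add, ENNReal.mul_inv, negExp, negExp]
  -- Exponentials of nonnegative arguments are nonzero, which excludes the product `0 * ∞`.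
  · left
    simp
  · right
    simp

lemma negExp_sum {ι : Type*} (s : Finset ι) (f : ι → ℝ≥0∞) :
    negExp (∑ i ∈ s, f i) = ∏ i ∈ s, negExp (f i) := by
  classical
  induction s using Finset.induction_on with
  | empty => simp
  | insert i s hi ih => rw [Finset.sum_insert hi, Finset.prod_insert hi, negExp_add, ih]

lemma negExp_mul_natCast (x : ℝ≥0∞) (n : ℕ) : negExp (x * n) = negExp x ^ n := by
  have := negExp_sum (Finset.range n) (fun _ => x)
  simpa [mul_comm] using this

lemma continuous_negExp : Continuous negExp :=
  continuous_inv.comp (ENNReal.continuous_exp.comp continuous_coe_ennreal_ereal)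

@[fun_prop]
lemma measurable_negExp : Measurable negExp := continuous_negExp.measurable

lemma negExp_antitone : Antitone negExp := fun x y h => by
  simpa [negExp] using h

lemma negExp_le_one (x : ℝ≥0∞) : negExp x ≤ 1 := by
  simpa using negExp_antitone (zero_le (a := x))

lemma negExp_ne_top (x : ℝ≥0∞) : negExp x ≠ ∞ := ((negExp_le_one x).trans_lt (by simp)).ne

/-- The Laplace transform of the Poisson distribution. -/
lemma lintegral_negExp_poissonMeasure (r : ℝ≥0) (y : ℝ≥0∞) :
    ∫⁻ k : ℕ, negExp (y * k) ∂(poissonMeasure r) = negExp (r * (1 - negExp y)) := by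
  set z : ℝ := (negExp y).toReal with hz
  have hz0 : 0 ≤ z := ENNReal.toReal_nonneg
  have hzy : negExp y = ENNReal.ofReal z := (ENNReal.ofReal_toReal (negExp_ne_top y)).symm
  have hz1 : z ≤ 1 := by
    rw [hz]
    exact ENNReal.toReal_le_of_le_ofReal zero_le_one (by simpa using negExp_le_one y)
  have hs : HasSum (fun k : ℕ => Real.exp (-r) * ((r * z) ^ k / k.factorial))
      (Real.exp (-r) * Real.exp (r * z)) := by
    have := (NormedSpace.expSeries_div_hasSum_exp (𝔸 := ℝ) ((r : ℝ) * z)).mul_left (Real.exp (-r))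
    rwa [← Real.exp_eq_exp_ℝ] at this
  have hr : (r : ℝ≥0∞) * (1 - negExp y) = ENNReal.ofReal (r * (1 - z)) := by
    rw [hzy, ENNReal.ofReal_mul r.coe_nonneg, ENNReal.ofReal_coe_nnreal,
      ENNReal.ofReal_sub _ hz0, ENNReal.ofReal_one]
  have h1 : Real.exp (-(r * (1 - z))) = Real.exp (-r) * Real.exp (r * z) := by
    rw [← Real.exp_add]
    ring_nf
  rw [lintegral_countable', hr, negExp_ofReal (mul_nonneg r.coe_nonneg (by linarith)), h1,
    ← hs.tsum_eq, ENNReal.ofReal_tsum_of_nonneg (fun k => by positivity) hs.summable]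
  refine tsum_congr fun k => ?_
  rw [negExp_mul_natCast, hzy, ← ENNReal.ofReal_pow hz0, poissonMeasure_singleton,
    ← ENNReal.ofReal_mul (by positivity)]
  congr 1
  rw [mul_pow]
  ring

/-! ### The Laplace functional of a Poisson process -/

section LaplaceFunctional

variable {Ω E : Type*} [MeasurableSpace E] {X : ℕ → Ω → E}

/-- The counting measure of the points. -/
def pointMeasure (X : ℕ → Ω → E) (w : Ω) : Measure E := Measure.sum fun a => Measure.dirac (X a w)

lemma lintegral_pointMeasure (X : ℕ → Ω → E) (w : Ω) {f : E → ℝ≥0∞} (hf : Measurable f) :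
    ∫⁻ x, f x ∂(pointMeasure X w) = ∑' a, f (X a w) := by
  rw [pointMeasure, lintegral_sum_measure]
  exact tsum_congr fun a => lintegral_dirac' _ hf

lemma pointMeasure_apply (X : ℕ → Ω → E) (w : Ω) {B : Set E} (hB : MeasurableSet B) :
    pointMeasure X w B = (count X B w : ℝ≥0∞) := by
  rw [← lintegral_indicator_one hB, lintegral_pointMeasure X w (measurable_one.indicator hB),
    count, ← ENNReal.tsum_set_one, tsum_subtype {a | X a w ∈ B} (fun _ => (1 : ℝ≥0∞))]
  rfl

variable [MeasurableSpace Ω] {Λ : Measure E} {Pr : Measure Ω}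

lemma measurable_pointMeasure_apply (hX : ∀ a, Measurable (X a)) {B : Set E}
    (hB : MeasurableSet B) : Measurable fun w => pointMeasure X w B := by
  have : (fun w => pointMeasure X w B) = fun w => ∑' a, B.indicator 1 (X a w) := by
    ext w
    rw [← lintegral_indicator_one hB, lintegral_pointMeasure X w (measurable_one.indicator hB)]
  rw [this]
  exact Measurable.tsum fun a => (measurable_one.indicator hB).comp (hX a)

namespace IsPoissonProcess

lemma lintegral_negExp_count (hX : IsPoissonProcess X Λ Pr) {B : Set E} (hB : MeasurableSet B)
    (hΛ : Λ B ≠ ∞) (y : ℝ≥0∞) :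
    ∫⁻ w, negExp (y * pointMeasure X w B) ∂Pr = negExp ((1 - negExp y) * Λ B) := by
  simp_rw [pointMeasure_apply X _ hB]
  rw [(hX.count_law B hB hΛ).lintegral_comp (f := fun k : ℕ∞ => negExp (y * (k : ℝ≥0∞)))
    (by fun_prop), lintegral_map (by fun_prop) (by fun_prop)]
  simp only [ENat.toENNReal_coe]
  rw [lintegral_negExp_poissonMeasure, ENNReal.coe_toNNReal hΛ, mul_comm]

/-- The process is given with independence over `Fin m`; the level sets of a simple function are
indexed by its values, hence the transport along `Fintype.equivFin`. -/
lemma iIndepFun_pointMeasure (hX : IsPoissonProcess X Λ Pr) {ι : Type*} [Fintype ι]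
    {B : ι → Set E} (hB : ∀ i, MeasurableSet (B i)) (hd : Pairwise (Function.onFun Disjoint B)) :
    iIndepFun (fun i w => pointMeasure X w (B i)) Pr := by
  let e := Fintype.equivFin ι
  have h := hX.count_indep (Fintype.card ι) (fun i => B (e.symm i)) (fun i => hB _)
    (fun i j hij => hd (e.symm.injective.ne hij))
  have h2 := (h.precomp e.injective).comp (mγ := fun _ => inferInstance)
    (fun _ k => (k : ℝ≥0∞)) (fun _ => by fun_prop)
  convert h2 using 2 with i
  ext w
  simp [pointMeasure_apply X w (hB i), e]

/-- The sum groups into values times counts of the disjoint level sets. Independence of the counts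
gives a product of Poisson transforms. -/
lemma lintegral_negExp_simpleFunc [IsProbabilityMeasure Pr] (hX : IsPoissonProcess X Λ Pr)
    (f : SimpleFunc E ℝ≥0∞) (hf : f.FinMeasSupp Λ) :
    ∫⁻ w, negExp (∑' a, f (X a w)) ∂Pr = negExp (∫⁻ x, (1 - negExp (f x)) ∂Λ) := by
  classical
  -- The value `0` contributes to neither side, and its level set may have infinite intensity.
  set s := f.range.filter (· ≠ 0)
  have h1 : ∀ w, negExp (∑' a, f (X a w))
      = ∏ y : s, negExp (y * pointMeasure X w (f ⁻¹' {(y : ℝ≥0∞)})) := fun w => by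
    rw [← lintegral_pointMeasure X w f.measurable, SimpleFunc.lintegral_eq_lintegral,
      SimpleFunc.lintegral, ← Finset.sum_filter_of_ne (p := (· ≠ 0)), negExp_sum,
      ← Finset.prod_coe_sort]
    intro y _ hy h0
    simp [h0] at hy
  have h2 : ∫⁻ x, (1 - negExp (f x)) ∂Λ = ∑ y : s, (1 - negExp y) * Λ (f ⁻¹' {(y : ℝ≥0∞)}) := by
    have := SimpleFunc.lintegral_eq_lintegral (f.map fun y => 1 - negExp y) Λ
    rw [SimpleFunc.map_lintegral] at this
    simp only [SimpleFunc.coe_map, Function.comp_apply] at this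
    rw [this, ← Finset.sum_filter_of_ne (p := (· ≠ 0)), ← Finset.sum_coe_sort]
    intro y _ hy h0
    simp [h0] at hy
  simp_rw [h1]
  have hd : Pairwise (Function.onFun Disjoint fun y : s => f ⁻¹' {(y : ℝ≥0∞)}) := by
    intro y z hyz
    refine Disjoint.preimage _ ?_
    exact disjoint_singleton.2 fun h => hyz (Subtype.ext h)
  have hi := (hX.iIndepFun_pointMeasure (B := fun y : s => f ⁻¹' {(y : ℝ≥0∞)})
    (fun y => f.measurableSet_fiber y) hd).comp (fun y k => negExp (y * k))
    (fun y => measurable_negExp.comp (by fun_prop))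
  have h3 := lintegral_prod_eq_prod_lintegral_of_indepFun Finset.univ _ hi
    (fun y => (measurable_negExp.comp (by fun_prop)).comp
      (measurable_pointMeasure_apply hX.measurable (f.measurableSet_fiber y)))
  simp only [Function.comp_apply] at h3
  rw [h3, h2, negExp_sum]
  refine Finset.prod_congr rfl fun y _ => ?_
  refine hX.lintegral_negExp_count (f.measurableSet_fiber y) ?_ y
  refine ((measure_mono ?_).trans_lt (SimpleFunc.finMeasSupp_iff_support.1 hf)).ne
  intro x hx h0
  have hy := (Finset.mem_filter.1 y.2).2
  exact hy (by rw [← (show f x = y from hx), h0])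

/-- The Laplace functional of a Poisson process. -/
theorem lintegral_negExp_tsum [IsProbabilityMeasure Pr] [SigmaFinite Λ]
    (hX : IsPoissonProcess X Λ Pr) {f : E → ℝ≥0∞} (hf : Measurable f) :
    ∫⁻ w, negExp (∑' a, f (X a w)) ∂Pr = negExp (∫⁻ x, (1 - negExp (f x)) ∂Λ) := by
  -- Cutting off to the increasing sets of finite intensity makes the simple-function case
  -- applicable and keeps the approximation monotone.
  set F : ℕ → SimpleFunc E ℝ≥0∞ :=
    fun n => (SimpleFunc.eapprox f n).restrict (spanningSets Λ n) with hF
  have hFapp : ∀ n x, F n x = (spanningSets Λ n).indicator (SimpleFunc.eapprox f n) x :=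
    fun n x => SimpleFunc.restrict_apply _ (measurableSet_spanningSets Λ n) x
  have hFsupp : ∀ n, (F n).FinMeasSupp Λ := fun n => by
    refine SimpleFunc.finMeasSupp_iff_support.2
      ((measure_mono ?_).trans_lt (measure_spanningSets_lt_top Λ n))
    intro x hx
    by_contra h
    exact hx (by rw [hFapp, indicator_of_notMem h])
  have hFmono : ∀ x, Monotone fun n => F n x := fun x m n hmn => by
    simp only [hFapp]
    exact (indicator_le_indicator (SimpleFunc.monotone_eapprox f hmn x)).trans
      (indicator_le_indicator_of_subset (monotone_spanningSets Λ hmn) (fun _ => zero_le) x)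
  have hFlim : ∀ x, Tendsto (fun n => F n x) atTop (𝓝 (f x)) := fun x => by
    refine (SimpleFunc.tendsto_eapprox hf x).congr' ?_
    filter_upwards [eventually_ge_atTop (spanningSetsIndex Λ x)] with n hn
    rw [hFapp, indicator_of_mem]
    exact monotone_spanningSets Λ hn (mem_spanningSetsIndex Λ x)
  have hL : Tendsto (fun n => ∫⁻ w, negExp (∑' a, F n (X a w)) ∂Pr) atTop
      (𝓝 (∫⁻ w, negExp (∑' a, f (X a w)) ∂Pr)) := by
    refine tendsto_lintegral_of_dominated_convergence (fun _ => 1)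
      (fun n => measurable_negExp.comp
        (Measurable.tsum fun a => (F n).measurable.comp (hX.measurable a)))
      (fun n => ae_of_all _ fun w => negExp_le_one _) (by simp) (ae_of_all _ fun w => ?_)
    refine (continuous_negExp.tendsto _).comp ?_
    -- As an integral against the counting measure, the series is amenable to monotone convergence.
    simp_rw [← lintegral_pointMeasure X w hf, ← lintegral_pointMeasure X w (F _).measurable]
    exact lintegral_tendsto_of_tendsto_of_monotone (fun n => (F n).measurable.aemeasurable)
      (ae_of_all _ hFmono) (ae_of_all _ hFlim)
  have hR : Tendsto (fun n => negExp (∫⁻ x, (1 - negExp (F n x)) ∂Λ)) atTop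
      (𝓝 (negExp (∫⁻ x, (1 - negExp (f x)) ∂Λ))) := by
    refine (continuous_negExp.tendsto _).comp ?_
    refine lintegral_tendsto_of_tendsto_of_monotone
      (fun n => ((measurable_negExp.comp (F n).measurable).const_sub 1).aemeasurable)
      (ae_of_all _ fun x m n hmn => tsub_le_tsub_left (negExp_antitone (hFmono x hmn)) 1)
      (ae_of_all _ fun x => ?_)
    exact ENNReal.Tendsto.sub tendsto_const_nhds
      ((continuous_negExp.tendsto _).comp (hFlim x)) (Or.inl (by simp))
  refine tendsto_nhds_unique hL (hR.congr fun n => ?_)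
  exact (hX.lintegral_negExp_simpleFunc (F n) (hFsupp n)).symm

end IsPoissonProcess

end LaplaceFunctional

/-! ### Independent marks -/

section Marks

variable {Ω : Type*} [MeasurableSpace Ω] {Pr : Measure Ω} [IsProbabilityMeasure Pr]

/-- Fubini's theorem for a function of two independent random variables. -/
lemma lintegral_comp_of_indepFun {S T : Type*} [MeasurableSpace S] [MeasurableSpace T]
    {U : Ω → S} {V : Ω → T} (hU : Measurable U) (hV : Measurable V) (hUV : IndepFun U V Pr)
    {G : S → T → ℝ≥0∞} (hG : Measurable (Function.uncurry G)) :
    ∫⁻ w, G (U w) (V w) ∂Pr = ∫⁻ w, ∫⁻ w', G (U w) (V w') ∂Pr ∂Pr := by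
  have h := (indepFun_iff_map_prod_eq_prod_map_map hU.aemeasurable hV.aemeasurable).1 hUV
  have := Measure.isProbabilityMeasure_map (μ := Pr) hV.aemeasurable
  calc ∫⁻ w, G (U w) (V w) ∂Pr = ∫⁻ p, Function.uncurry G p ∂(Pr.map fun w => (U w, V w)) := by
        rw [lintegral_map hG (hU.prodMk hV)]
        rfl
    _ = ∫⁻ u, ∫⁻ v, Function.uncurry G (u, v) ∂(Pr.map V) ∂(Pr.map U) := by
        rw [h, lintegral_prod _ hG.aemeasurable]
    _ = ∫⁻ w, ∫⁻ w', G (U w) (V w') ∂Pr ∂Pr := by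
        rw [lintegral_map hG.lintegral_prod_right' hU]
        refine lintegral_congr fun w => ?_
        exact lintegral_map (hG.comp measurable_prodMk_left) hV

/-- Both hypotheses make the joint law of the triple a product, which can be reassociated. Applied
twice to the chained independence in `IsNetwork`, this separates the environment from the link gain.
-/
lemma indepFun_prodMk_left_of_indepFun {S T R : Type*} [MeasurableSpace S] [MeasurableSpace T]
    [MeasurableSpace R] {U : Ω → S} {V : Ω → T} {W : Ω → R} (hU : Measurable U)
    (hV : Measurable V) (hW : Measurable W) (h : IndepFun U (fun w => (V w, W w)) Pr)
    (h' : IndepFun V W Pr) : IndepFun (fun w => (U w, V w)) W Pr := by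
  have h1 := (indepFun_iff_map_prod_eq_prod_map_map hU.aemeasurable
    (hV.prodMk hW).aemeasurable).1 h
  have h2 := (indepFun_iff_map_prod_eq_prod_map_map hV.aemeasurable hW.aemeasurable).1 h'
  have h3 := (indepFun_iff_map_prod_eq_prod_map_map hU.aemeasurable hV.aemeasurable).1
    (h.comp measurable_id measurable_fst)
  have i1 := Measure.isProbabilityMeasure_map (μ := Pr) hV.aemeasurable
  have i2 := Measure.isProbabilityMeasure_map (μ := Pr) hW.aemeasurable
  have i3 := Measure.isProbabilityMeasure_map (μ := Pr) hU.aemeasurable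
  refine (indepFun_iff_map_prod_eq_prod_map_map (hU.prodMk hV).aemeasurable hW.aemeasurable).2 ?_
  change Pr.map (fun w => (U w, V w)) = _ at h3
  have h4 : Pr.map (fun w => ((U w, V w), W w))
      = (Pr.map fun w => (U w, (V w, W w))).map MeasurableEquiv.prodAssoc.symm := by
    rw [Measure.map_map (MeasurableEquiv.measurable _) (by fun_prop)]
    rfl
  rw [h4, h1, h2, h3, ← Measure.prodAssoc_prod, MeasurableEquiv.map_symm_map]

end Marks

/-- The Laplace transform of the standard exponential distribution. -/
lemma lintegral_negExp_expMeasure {r : ℝ} (hr : 0 ≤ r) :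
    ∫⁻ y, negExp (ENNReal.ofReal y * ENNReal.ofReal r) ∂(expMeasure 1)
      = ENNReal.ofReal (1 / (1 + r)) := by
  -- Tilting the density of rate `1` by `exp (-r y)` gives a multiple of the density of rate `1 +
  -- r`, whose mass is `1`.
  have h : ∀ y, exponentialPDF 1 y * negExp (ENNReal.ofReal y * ENNReal.ofReal r)
      = ENNReal.ofReal (1 / (1 + r)) * exponentialPDF (1 + r) y := fun y => by
    rcases lt_or_ge y 0 with hy | hy
    · rw [exponentialPDF_of_neg hy, exponentialPDF_of_neg hy, zero_mul, mul_zero]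
    · rw [exponentialPDF_of_nonneg hy, exponentialPDF_of_nonneg hy, ← ENNReal.ofReal_mul hy,
        negExp_ofReal (mul_nonneg hy hr), ← ENNReal.ofReal_mul (by positivity),
        ← ENNReal.ofReal_mul (by positivity)]
      congr 1
      rw [← mul_assoc, one_div, inv_mul_cancel₀ (by positivity), one_mul, one_mul, ← Real.exp_add]
      ring_nf
  have hd : expMeasure 1 = volume.withDensity (exponentialPDF 1) := rfl
  have hm : ∀ r, Measurable (exponentialPDF r) :=
    fun r => (measurable_exponentialPDFReal r).ennreal_ofReal
  rw [hd, lintegral_withDensity_eq_lintegral_mul _ (hm 1) (by fun_prop)]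
  simp only [Pi.mul_apply, h]
  rw [lintegral_const_mul _ (hm _), lintegral_exponentialPDF_eq_one (by positivity), mul_one]

/-- The contribution of an active transmitter with fading gain `y` at a point of path gain `r`. -/
def contribution (r : ℝ) (b : Bool) (y : ℝ) : ℝ≥0∞ :=
  if b = true then ENNReal.ofReal y * ENNReal.ofReal r else 0

lemma measurable_contribution {S : Type*} [MeasurableSpace S] {r : S → ℝ} {b : S → Bool}
    {y : S → ℝ} (hr : Measurable r) (hb : Measurable b) (hy : Measurable y) :
    Measurable fun p => contribution (r p) (b p) (y p) :=
  Measurable.ite (hb (measurableSet_singleton true)) (by fun_prop) measurable_const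

/-! ### Shot noise of the active transmitters: averaging over marks, then over locations -/

namespace IsNetwork

variable {Ω : Type*} [MeasurableSpace Ω] {Pr : Measure Ω} [IsProbabilityMeasure Pr]
  {X : ℕ → Ω → Plane} {c : ℕ → Ω → Bool} {h : ℕ → Ω → ℝ} {g : Ω → ℝ} {ζ l lam : ℝ}

/-- An active transmitter contributes the factor `1 / (1 + r)`, an inactive one the factor `1`. The
iterated integral is the form in which Fubini leaves independent states and gains. -/
lemma lintegral_negExp_contribution (hnet : IsNetwork X c h g ζ l lam Pr) (hl : 0 ≤ l)
    (hl1 : l ≤ 1) {r : ℝ} (hr : 0 ≤ r) (a : ℕ) :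
    ∫⁻ w, ∫⁻ w', negExp (contribution r (c a w) (h a w')) ∂Pr ∂Pr
      = ENNReal.ofReal (1 - l * r / (1 + r)) := by
  have h1 : ∀ b, ∫⁻ w', negExp (contribution r b (h a w')) ∂Pr
      = if b = true then ENNReal.ofReal (1 / (1 + r)) else 1 := fun b => by
    rcases b with _ | _
    · simp [contribution]
    · simp only [contribution, if_true]
      rw [← lintegral_negExp_expMeasure hr, (hnet.law_h a).lintegral_comp
        (f := fun y => negExp (ENNReal.ofReal y * ENNReal.ofReal r)) (by fun_prop)]
  simp_rw [h1]
  have hm : MeasurableSet {w | c a w = true} := hnet.measurable_c a (measurableSet_singleton true)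
  have h2 : ∀ w, (if c a w = true then ENNReal.ofReal (1 / (1 + r)) else 1)
      = {w | c a w = true}.indicator (fun _ => ENNReal.ofReal (1 / (1 + r))) w
        + {w | c a w = true}ᶜ.indicator (fun _ => 1) w := fun w => by
    by_cases hw : c a w = true <;> simp [hw]
  simp_rw [h2]
  rw [lintegral_add_left (measurable_const.indicator hm), lintegral_indicator_const hm,
    lintegral_indicator_const hm.compl, prob_compl_eq_one_sub hm, hnet.load a, one_mul,
    ← ENNReal.ofReal_mul (by positivity), ← ENNReal.ofReal_one, ← ENNReal.ofReal_sub _ hl,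
    ← ENNReal.ofReal_add (by positivity) (by linarith)]
  congr 1
  field_simp
  ring

/-- Averaging a finite product over the marks. -/
lemma lintegral_prod_negExp_contribution (hnet : IsNetwork X c h g ζ l lam Pr) (hl : 0 ≤ l)
    (hl1 : l ≤ 1) {ℓ : Plane → ℝ} (hℓ : Measurable ℓ) (hℓ0 : ∀ x, 0 ≤ ℓ x) (n : ℕ) :
    ∫⁻ w, ∏ a ∈ Finset.range n, negExp (contribution (ℓ (X a w)) (c a w) (h a w)) ∂Pr
      = ∫⁻ w, ∏ a ∈ Finset.range n,
        ENNReal.ofReal (1 - l * ℓ (X a w) / (1 + ℓ (X a w))) ∂Pr := by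
  have mX : Measurable fun w a => X a w := measurable_pi_lambda _ hnet.poisson.measurable
  have mc : Measurable fun w a => c a w := measurable_pi_lambda _ hnet.measurable_c
  have mh : Measurable fun w a => h a w := measurable_pi_lambda _ hnet.measurable_h
  have mg := hnet.measurable_g
  -- Locations are frozen first, then states; the product factors over the gains and afterwards over
  -- the states.
  rw [lintegral_comp_of_indepFun (G := fun x m => ∏ a ∈ Finset.range n,
      negExp (contribution (ℓ (x a)) (m.1 a) (m.2.1 a))) mX
    (mc.prodMk (mh.prodMk mg)) hnet.indep_X]
  swap
  · refine Finset.measurable_prod _ fun a _ => measurable_negExp.comp ?_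
    exact measurable_contribution (by fun_prop) (by fun_prop) (by fun_prop)
  refine lintegral_congr fun w => ?_
  rw [lintegral_comp_of_indepFun (G := fun b m => ∏ a ∈ Finset.range n,
      negExp (contribution (ℓ (X a w)) (b a) (m.1 a))) mc (mh.prodMk mg) hnet.indep_c_hg]
  swap
  · refine Finset.measurable_prod _ fun a _ => measurable_negExp.comp ?_
    exact measurable_contribution (by fun_prop) (by fun_prop) (by fun_prop)
  have h1 : ∀ w', ∫⁻ w'', ∏ a ∈ Finset.range n,
      negExp (contribution (ℓ (X a w)) (c a w') (h a w'')) ∂Pr = ∏ a ∈ Finset.range n,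
        ∫⁻ w'', negExp (contribution (ℓ (X a w)) (c a w') (h a w'')) ∂Pr := fun w' => by
    have hm : ∀ a, Measurable fun y : ℝ => negExp (contribution (ℓ (X a w)) (c a w') y) :=
      fun a => measurable_negExp.comp
        (measurable_contribution measurable_const measurable_const measurable_id)
    exact lintegral_prod_eq_prod_lintegral_of_indepFun _ _ (hnet.indep_h.comp _ hm)
      fun a => (hm a).comp (hnet.measurable_h a)
  simp_rw [h1]
  have hm : ∀ a, Measurable fun b : Bool =>
      ∫⁻ w'', negExp (contribution (ℓ (X a w)) b (h a w'')) ∂Pr := fun a => measurable_from_top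
  refine (lintegral_prod_eq_prod_lintegral_of_indepFun _ _ (hnet.indep_c.comp _ hm)
      fun a => (hm a).comp (hnet.measurable_c a)).trans ?_
  exact Finset.prod_congr rfl fun a _ =>
    hnet.lintegral_negExp_contribution hl hl1 (hℓ0 _) a

/-- Mutual independence factors finite products only; domination by `1` permits the limit. -/
lemma tendsto_lintegral_prod_negExp {f : ℕ → Ω → ℝ≥0∞} (hf : ∀ a, Measurable (f a)) :
    Tendsto (fun n => ∫⁻ w, ∏ a ∈ Finset.range n, negExp (f a w) ∂Pr) atTop
      (𝓝 (∫⁻ w, negExp (∑' a, f a w) ∂Pr)) := by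
  simp_rw [← negExp_sum]
  refine tendsto_lintegral_of_dominated_convergence (fun _ => 1)
    (fun n => by fun_prop) (fun n => ae_of_all _ fun w => negExp_le_one _) (by simp)
    (ae_of_all _ fun w => ?_)
  exact (continuous_negExp.tendsto _).comp ENNReal.summable.hasSum.tendsto_sum_nat

/-- The Laplace transform of the sum over the active transmitters of fading gain times path
gain. -/
theorem lintegral_negExp_tsum_contribution (hnet : IsNetwork X c h g ζ l lam Pr) (hl : 0 ≤ l)
    (hl1 : l ≤ 1) {ℓ : Plane → ℝ} (hℓ : Measurable ℓ) (hℓ0 : ∀ x, 0 ≤ ℓ x) :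
    ∫⁻ w, negExp (∑' a, contribution (ℓ (X a w)) (c a w) (h a w)) ∂Pr
      = negExp (ENNReal.ofReal ζ * ∫⁻ x, ENNReal.ofReal (l * ℓ x / (1 + ℓ x))) := by
  set φ : Plane → ℝ := fun x => 1 - l * ℓ x / (1 + ℓ x) with hφ
  have hφm : Measurable φ := by fun_prop
  have hφ0 : ∀ x, 0 < φ x := fun x => by
    have := hℓ0 x
    rw [hφ]
    simp only
    rw [sub_pos, div_lt_one (by positivity)]
    nlinarith
  have hφ1 : ∀ x, φ x ≤ 1 := fun x => by
    have := hℓ0 x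
    have : 0 ≤ l * ℓ x / (1 + ℓ x) := by positivity
    simp only [hφ]
    linarith
  -- The averaged mark factor `φ` is absorbed into a new function `-log φ` of the location, so no
  -- marked process is needed.
  have hφe : ∀ x, negExp (ENNReal.ofReal (-Real.log (φ x))) = ENNReal.ofReal (φ x) := fun x => by
    rw [negExp_ofReal (neg_nonneg.2 (Real.log_nonpos (hφ0 x).le (hφ1 x))), neg_neg,
      Real.exp_log (hφ0 x)]
  have hmf : Measurable fun x => ENNReal.ofReal (-Real.log (φ x)) := by fun_prop
  have h1 := tendsto_lintegral_prod_negExp (Pr := Pr)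
    (f := fun a w => contribution (ℓ (X a w)) (c a w) (h a w))
    fun a => measurable_contribution (hℓ.comp (hnet.poisson.measurable a)) (hnet.measurable_c a)
      (hnet.measurable_h a)
  have h2 := tendsto_lintegral_prod_negExp (Pr := Pr)
    (f := fun a w => ENNReal.ofReal (-Real.log (φ (X a w))))
    fun a => hmf.comp (hnet.poisson.measurable a)
  simp_rw [hφe] at h2
  simp_rw [hnet.lintegral_prod_negExp_contribution hl hl1 hℓ hℓ0] at h1
  have : SigmaFinite (ENNReal.ofReal ζ • (volume : Measure Plane)) :=
    inferInstanceAs (SigmaFinite (ζ.toNNReal • (volume : Measure Plane)))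
  rw [tendsto_nhds_unique h1 h2, hnet.poisson.lintegral_negExp_tsum hmf, lintegral_smul_measure,
    smul_eq_mul]
  congr 2
  refine lintegral_congr fun x => ?_
  rw [hφe, ← ENNReal.ofReal_one, ← ENNReal.ofReal_sub _ (hφ0 x).le]
  congr 1
  simp [hφ]

end IsNetwork

/-! ### The integral over the plane -/

/-- The primitive comes from the substitution `u = r ^ 2`, which turns `r t / (r ^ 4 + t) dr` into
`(t / 2) du / (u ^ 2 + t)`. -/
lemma hasDerivAt_arctan_sq_div_sqrt {t : ℝ} (ht : 0 < t) (r : ℝ) :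
    HasDerivAt (fun r => √t / 2 * Real.arctan (r ^ 2 / √t)) (r * (t / (r ^ 4 + t))) r := by
  have hs : 0 < √t := Real.sqrt_pos.2 ht
  have h := ((((hasDerivAt_id r).pow 2).div_const (√t)).arctan).const_mul (√t / 2)
  refine h.congr_deriv ?_
  simp only [id, Pi.pow_apply, div_pow, Real.sq_sqrt ht.le]
  field_simp
  norm_num
  exact Or.inl (add_comm _ _)

lemma tendsto_arctan_sq_div_sqrt {t : ℝ} (ht : 0 < t) :
    Tendsto (fun r => √t / 2 * Real.arctan (r ^ 2 / √t)) atTop (𝓝 (√t / 2 * (Real.pi / 2))) := by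
  refine Tendsto.const_mul _ ?_
  exact (tendsto_nhds_of_tendsto_nhdsWithin Real.tendsto_arctan_atTop).comp
    ((tendsto_pow_atTop two_ne_zero).atTop_div_const (Real.sqrt_pos.2 ht))

lemma integrableOn_mul_div_pow_four_add {t : ℝ} (ht : 0 < t) :
    IntegrableOn (fun r : ℝ => r * (t / (r ^ 4 + t))) (Ioi 0) :=
  integrableOn_Ioi_deriv_of_nonneg' (fun r _ => hasDerivAt_arctan_sq_div_sqrt ht r)
    (fun r hr => mul_nonneg (le_of_lt hr) (by positivity)) (tendsto_arctan_sq_div_sqrt ht)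

lemma integral_mul_div_pow_four_add {t : ℝ} (ht : 0 < t) :
    ∫ r in Ioi (0 : ℝ), r * (t / (r ^ 4 + t)) = Real.pi * √t / 4 := by
  rw [integral_Ioi_of_hasDerivAt_of_nonneg' (fun r _ => hasDerivAt_arctan_sq_div_sqrt ht r)
    (fun r hr => mul_nonneg (le_of_lt hr) (by positivity)) (tendsto_arctan_sq_div_sqrt ht)]
  simp
  ring

/-- The integral over the plane of the rational transform of the path gain of exponent `4`. -/
lemma lintegral_pathGain {l t : ℝ} (hl : 0 ≤ l) (ht : 0 ≤ t) (x₀ : Plane) :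
    ∫⁻ x, ENNReal.ofReal (l * (t * ‖x - x₀‖ ^ (-4 : ℝ)) / (1 + t * ‖x - x₀‖ ^ (-4 : ℝ)))
      = ENNReal.ofReal (l * Real.pi ^ 2 * √t / 2) := by
  rcases ht.eq_or_lt with rfl | ht
  · simp
  set f : ℝ → ℝ := fun r => l * (t * r ^ (-4 : ℝ)) / (1 + t * r ^ (-4 : ℝ)) with hf
  have hfr : ∀ r ∈ Ioi (0 : ℝ), r ^ (Module.finrank ℝ Plane - 1) • f r
      = l * (r * (t / (r ^ 4 + t))) := fun r hr => by
    have hr : 0 < r := hr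
    have h4 : r ^ (-4 : ℝ) = (r ^ 4)⁻¹ := by
      rw [Real.rpow_neg hr.le]
      norm_cast
    simp only [hf, finrank_euclideanSpace, Fintype.card_fin, smul_eq_mul, h4]
    field_simp
    norm_num
    ring
  have hint : Integrable (fun x : Plane => f ‖x‖) := by
    rw [integrable_fun_norm_addHaar, integrableOn_congr_fun hfr measurableSet_Ioi]
    exact (integrableOn_mul_div_pow_four_add ht).const_mul l
  -- In polar coordinates: the dimension `2`, times the area `π` of the unit disc, times the radial
  -- integral `l π √t / 4`.
  have hval : ∫ x : Plane, f ‖x‖ = l * Real.pi ^ 2 * √t / 2 := by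
    rw [integral_fun_norm_addHaar, setIntegral_congr_fun measurableSet_Ioi hfr,
      integral_const_mul, integral_mul_div_pow_four_add ht, measureReal_def,
      EuclideanSpace.volume_ball_fin_two]
    simp [Real.pi_pos.le]
    ring
  have hnn : ∀ x : Plane, 0 ≤ f ‖x‖ := fun x => by
    simp only [hf]
    positivity
  rw [lintegral_sub_right_eq_self (fun x : Plane => ENNReal.ofReal (f ‖x‖)) x₀,
    ← ofReal_integral_eq_lintegral_ofReal hint (ae_of_all _ hnn), hval]

/-! ### The complementary error function -/

lemma integrable_exp_neg_sq : Integrable fun t : ℝ => Real.exp (-t ^ 2) := by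
  simpa using integrable_exp_neg_mul_sq (one_pos)

lemma integral_Ioi_exp_neg_sq : ∫ t in Ioi (0 : ℝ), Real.exp (-t ^ 2) = √Real.pi / 2 := by
  simpa using integral_gaussian_Ioi 1

/-- A variable upper limit makes the fundamental theorem of calculus applicable. -/
lemma erfc_eq (x : ℝ) : erfc x = 1 - 2 / √Real.pi * ∫ t in (0 : ℝ)..x, Real.exp (-t ^ 2) := by
  have h := intervalIntegral.integral_interval_add_Ioi
    (integrable_exp_neg_sq.integrableOn (s := Ioi 0)) (integrable_exp_neg_sq.integrableOn (s := Ioi x))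
  rw [integral_Ioi_exp_neg_sq] at h
  have hp : 0 < √Real.pi := Real.sqrt_pos.2 Real.pi_pos
  rw [erfc, eq_sub_iff_add_eq, ← mul_add, add_comm, h]
  field_simp

lemma hasDerivAt_erfc (x : ℝ) : HasDerivAt erfc (-(2 / √Real.pi * Real.exp (-x ^ 2))) x := by
  have hc : Continuous fun t : ℝ => Real.exp (-t ^ 2) := by fun_prop
  have h := ((hc.integral_hasStrictDerivAt 0 x).hasDerivAt.const_mul (2 / √Real.pi)).const_sub 1
  exact h.congr_of_eventuallyEq (Eventually.of_forall erfc_eq)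

lemma erfc_zero : erfc 0 = 1 := by simp [erfc_eq]

lemma erfc_neg (x : ℝ) : erfc (-x) = 2 - erfc x := by
  have h : ∫ t in (0 : ℝ)..(-x), Real.exp (-t ^ 2) = -∫ t in (0 : ℝ)..x, Real.exp (-t ^ 2) := by
    have := intervalIntegral.integral_comp_neg (a := 0) (b := x) fun t : ℝ => Real.exp (-t ^ 2)
    simp only [neg_sq, neg_zero] at this
    rw [this, intervalIntegral.integral_symm]
  rw [erfc_eq, erfc_eq x, h]
  ring

lemma tendsto_erfc_atTop : Tendsto erfc atTop (𝓝 0) := by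
  have h := intervalIntegral_tendsto_integral_Ioi 0
    (integrable_exp_neg_sq.integrableOn (s := Ioi 0)) tendsto_id
  have h2 := (h.const_mul (2 / √Real.pi)).const_sub 1
  have hp : 0 < √Real.pi := Real.sqrt_pos.2 Real.pi_pos
  rw [integral_Ioi_exp_neg_sq, show 1 - 2 / √Real.pi * (√Real.pi / 2) = 0 by field_simp; simp] at h2
  exact h2.congr fun x => (erfc_eq x).symm

lemma tendsto_erfc_atBot : Tendsto erfc atBot (𝓝 2) := by
  have h := (tendsto_erfc_atTop.comp tendsto_neg_atBot_atTop).const_sub 2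
  rw [sub_zero] at h
  refine h.congr fun x => ?_
  simp [erfc_neg]

/-! ### The Lévy density -/

/-- The scale parameter of the law of the incident power. -/
def levyScale (ζ PA : ℝ) : ℝ := ζ * √PA * Real.pi ^ 2 / 4

lemma levyScale_pos {ζ PA : ℝ} (hζ : 0 < ζ) (hPA : 0 < PA) : 0 < levyScale ζ PA := by
  have := Real.sqrt_pos.2 hPA
  have := Real.pi_pos
  unfold levyScale
  positivity

lemma cdfPI_eq (ζ PA ρ : ℝ) : cdfPI ζ PA ρ = erfc (levyScale ζ PA / √ρ) := by
  rw [cdfPI, levyScale, div_div]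

lemma pdfPI_nonneg {ζ PA : ℝ} (hζ : 0 ≤ ζ) {ρ : ℝ} (hρ : 0 < ρ) : 0 ≤ pdfPI ζ PA ρ := by
  have := Real.pi_pos
  unfold pdfPI
  positivity

lemma measurable_pdfPI (ζ PA : ℝ) : Measurable (pdfPI ζ PA) := by
  unfold pdfPI
  fun_prop

lemma pdfPI_eq {ζ PA : ℝ} (hPA : 0 ≤ PA) {ρ : ℝ} (hρ : 0 < ρ) :
    pdfPI ζ PA ρ = levyScale ζ PA / (√Real.pi * (ρ * √ρ)) *
      Real.exp (-(levyScale ζ PA ^ 2 / ρ)) := by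
  have h1 : (Real.pi / ρ) ^ (3 / 2 : ℝ) = Real.pi * √Real.pi / (ρ * √ρ) := by
    rw [show (3 / 2 : ℝ) = 1 + 1 / 2 by norm_num, Real.rpow_add (div_pos Real.pi_pos hρ),
      Real.rpow_one, ← Real.sqrt_eq_rpow, Real.sqrt_div Real.pi_pos.le]
    ring
  have h2 : levyScale ζ PA ^ 2 / ρ = Real.pi ^ 4 * ζ ^ 2 * PA / (16 * ρ) := by
    rw [levyScale, div_pow, mul_pow, mul_pow, Real.sq_sqrt hPA]
    field_simp
    ring
  have hp : 0 < √Real.pi := Real.sqrt_pos.2 Real.pi_pos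
  rw [pdfPI, h1, h2, levyScale]
  congr 1
  have h3 : Real.pi = √Real.pi ^ 2 := (Real.sq_sqrt Real.pi_pos.le).symm
  field_simp
  rw [← h3]

/-- A primitive on `(0, ∞)` of `ρ ↦ exp (-q ^ 2 * ρ)` times the Lévy density of scale `k`. -/
def levyPrimitive (k q ρ : ℝ) : ℝ :=
  if ρ ≤ 0 then 0 else
    1 / 2 * (Real.exp (2 * k * q) * erfc (k / √ρ + q * √ρ)
      + Real.exp (-(2 * k * q)) * erfc (k / √ρ - q * √ρ))

lemma levyPrimitive_of_pos (k q : ℝ) {ρ : ℝ} (hρ : 0 < ρ) :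
    levyPrimitive k q ρ = 1 / 2 * (Real.exp (2 * k * q) * erfc (k / √ρ + q * √ρ)
      + Real.exp (-(2 * k * q)) * erfc (k / √ρ - q * √ρ)) := by
  rw [levyPrimitive, if_neg hρ.not_ge]

lemma levyPrimitive_zero_right (k : ℝ) {ρ : ℝ} (hρ : 0 < ρ) :
    levyPrimitive k 0 ρ = erfc (k / √ρ) := by
  rw [levyPrimitive_of_pos k 0 hρ]
  simp
  ring

/-- Since `(k / √ρ ± q √ρ) ^ 2 = k ^ 2 / ρ ± 2 k q + q ^ 2 ρ`, the prefactors `exp (± 2 k q)` leave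
the same Gaussian factor in both terms. The derivatives of `q √ρ` then cancel and those of `k / √ρ`
add up. -/
lemma hasDerivAt_levyPrimitive (k q : ℝ) {ρ : ℝ} (hρ : 0 < ρ) :
    HasDerivAt (levyPrimitive k q)
      (Real.exp (-(q ^ 2 * ρ)) * (k / (√Real.pi * (ρ * √ρ)) * Real.exp (-(k ^ 2 / ρ)))) ρ := by
  have hs : 0 < √ρ := Real.sqrt_pos.2 hρ
  have hss : √ρ ^ 2 = ρ := Real.sq_sqrt hρ.le
  have hp : 0 < √Real.pi := Real.sqrt_pos.2 Real.pi_pos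
  have hd := Real.hasDerivAt_sqrt hρ.ne'
  have hkd := (hasDerivAt_const ρ k).div hd hs.ne'
  have hqd := hd.const_mul q
  have h := (((hasDerivAt_erfc _).comp ρ (hkd.add hqd)).const_mul (Real.exp (2 * k * q))).add
    (((hasDerivAt_erfc _).comp ρ (hkd.sub hqd)).const_mul (Real.exp (-(2 * k * q))))
  have h' := (h.const_mul (1 / 2)).congr_of_eventuallyEq (f₁ := levyPrimitive k q) (by
    filter_upwards [lt_mem_nhds hρ] with x hx
    rw [levyPrimitive_of_pos k q hx]
    rfl)
  refine h'.congr_deriv ?_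
  have x1 : (k / √ρ + q * √ρ) ^ 2 = k ^ 2 / √ρ ^ 2 + 2 * k * q + q ^ 2 * √ρ ^ 2 := by
    field_simp
    ring
  have e1 : Real.exp (-(k / √ρ + q * √ρ) ^ 2) = Real.exp (-(q ^ 2 * ρ)) *
      Real.exp (-(k ^ 2 / ρ)) * Real.exp (-(2 * k * q)) := by
    rw [← Real.exp_add, ← Real.exp_add]
    congr 1
    rw [x1, hss]
    ring
  have x2 : (k / √ρ - q * √ρ) ^ 2 = k ^ 2 / √ρ ^ 2 - 2 * k * q + q ^ 2 * √ρ ^ 2 := by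
    field_simp
    ring
  have e2 : Real.exp (-(k / √ρ - q * √ρ) ^ 2) = Real.exp (-(q ^ 2 * ρ)) *
      Real.exp (-(k ^ 2 / ρ)) * Real.exp (2 * k * q) := by
    rw [← Real.exp_add, ← Real.exp_add]
    congr 1
    rw [x2, hss]
    ring
  have e3 : Real.exp (-(2 * k * q)) = (Real.exp (2 * k * q))⁻¹ := Real.exp_neg _
  simp only [Pi.add_apply, Pi.sub_apply, Pi.div_apply, e1, e2, e3]
  have he := Real.exp_pos (2 * k * q)
  generalize Real.exp (-(q ^ 2 * ρ)) = A
  generalize Real.exp (-(k ^ 2 / ρ)) = B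
  generalize Real.exp (2 * k * q) = C at he ⊢
  rw [show ρ * √ρ = √ρ ^ 3 by rw [pow_succ, hss]]
  generalize √ρ = r at hs ⊢
  field_simp
  ring

lemma tendsto_const_div_sqrt_atTop (k : ℝ) : Tendsto (fun ρ : ℝ => k / √ρ) atTop (𝓝 0) :=
  Real.tendsto_sqrt_atTop.const_div_atTop k

lemma tendsto_const_div_sqrt_zero {k : ℝ} (hk : 0 < k) :
    Tendsto (fun ρ : ℝ => k / √ρ) (𝓝[>] 0) atTop := by
  have h : Tendsto (fun ρ : ℝ => √ρ) (𝓝[>] 0) (𝓝[>] 0) := by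
    refine tendsto_nhdsWithin_iff.2 ⟨?_, ?_⟩
    · have := (Real.continuous_sqrt.tendsto 0).mono_left (nhdsWithin_le_nhds (s := Ioi 0))
      simpa using this
    · filter_upwards [self_mem_nhdsWithin] with ρ hρ
      exact Real.sqrt_pos.2 hρ
  exact (h.inv_tendsto_nhdsGT_zero).const_mul_atTop hk

/-- Both arguments of `erfc` tend to `+∞` as `ρ` decreases to `0`, because `k > 0`; the value `0`
assigned to `ρ ≤ 0` is thus the right limit. -/
lemma continuousWithinAt_levyPrimitive {k : ℝ} (hk : 0 < k) (q : ℝ) :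
    ContinuousWithinAt (levyPrimitive k q) (Ici 0) 0 := by
  rw [← continuousWithinAt_Ioi_iff_Ici, ContinuousWithinAt]
  have hq : Tendsto (fun ρ : ℝ => q * √ρ) (𝓝[>] 0) (𝓝 0) := by
    have : Continuous fun ρ : ℝ => q * √ρ := by fun_prop
    have := (this.tendsto 0).mono_left (nhdsWithin_le_nhds (s := Ioi 0))
    simpa using this
  have h1 := tendsto_erfc_atTop.comp ((tendsto_const_div_sqrt_zero hk).atTop_add hq)
  have h2 := tendsto_erfc_atTop.comp ((tendsto_const_div_sqrt_zero hk).atTop_add hq.neg)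
  have h3 := ((h1.const_mul (Real.exp (2 * k * q))).add
    (h2.const_mul (Real.exp (-(2 * k * q))))).const_mul (1 / 2)
  have h0 : levyPrimitive k q 0 = 0 := by simp [levyPrimitive]
  simp only [mul_zero, add_zero] at h3
  rw [h0]
  refine h3.congr' ?_
  filter_upwards [self_mem_nhdsWithin] with ρ hρ
  rw [levyPrimitive_of_pos k q hρ]
  simp [sub_eq_add_neg]

/-- For `q > 0` the arguments of `erfc` tend to `+∞` and `-∞`, where its limits are `0` and `2`; for
`q = 0` both tend to `0`, where it equals `1`. -/
lemma tendsto_levyPrimitive_atTop (k : ℝ) {q : ℝ} (hq : 0 ≤ q) :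
    Tendsto (levyPrimitive k q) atTop (𝓝 (Real.exp (-(2 * k * q)))) := by
  rcases hq.eq_or_lt with rfl | hq
  · have h := ((hasDerivAt_erfc 0).continuousAt.tendsto).comp (tendsto_const_div_sqrt_atTop k)
    rw [erfc_zero] at h
    simp only [mul_zero, neg_zero, Real.exp_zero]
    refine h.congr' ?_
    filter_upwards [eventually_gt_atTop 0] with ρ hρ
    rw [levyPrimitive_zero_right k hρ]
    rfl
  · have hqs := Real.tendsto_sqrt_atTop.const_mul_atTop hq
    have h1 := tendsto_erfc_atTop.comp ((tendsto_const_div_sqrt_atTop k).add_atTop hqs)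
    have h2 := tendsto_erfc_atBot.comp
      ((tendsto_const_div_sqrt_atTop k).add_atBot (tendsto_neg_atTop_atBot.comp hqs))
    have h3 := ((h1.const_mul (Real.exp (2 * k * q))).add
      (h2.const_mul (Real.exp (-(2 * k * q))))).const_mul (1 / 2)
    rw [show 1 / 2 * (Real.exp (2 * k * q) * 0 + Real.exp (-(2 * k * q)) * 2)
      = Real.exp (-(2 * k * q)) by ring] at h3
    refine h3.congr' ?_
    filter_upwards [eventually_gt_atTop 0] with ρ hρ
    rw [levyPrimitive_of_pos k q hρ]
    simp [sub_eq_add_neg]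

section Law

variable {ζ PA : ℝ}

lemma hasDerivAt_levyPrimitive_pdfPI (hPA : 0 ≤ PA) {s : ℝ} (hs : 0 ≤ s) {ρ : ℝ} (hρ : 0 < ρ) :
    HasDerivAt (levyPrimitive (levyScale ζ PA) √s) (Real.exp (-(s * ρ)) * pdfPI ζ PA ρ) ρ := by
  have := hasDerivAt_levyPrimitive (levyScale ζ PA) √s hρ
  rwa [Real.sq_sqrt hs, ← pdfPI_eq hPA hρ] at this

lemma integrableOn_exp_mul_pdfPI (hζ : 0 < ζ) (hPA : 0 < PA) {s : ℝ} (hs : 0 ≤ s) :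
    IntegrableOn (fun ρ => Real.exp (-(s * ρ)) * pdfPI ζ PA ρ) (Ioi 0) :=
  integrableOn_Ioi_deriv_of_nonneg (continuousWithinAt_levyPrimitive (levyScale_pos hζ hPA) √s)
    (fun _ hρ => hasDerivAt_levyPrimitive_pdfPI hPA.le hs hρ)
    (fun _ hρ => mul_nonneg (Real.exp_pos _).le (pdfPI_nonneg hζ.le hρ))
    (tendsto_levyPrimitive_atTop _ (Real.sqrt_nonneg s))

/-- The Laplace transform of the density. -/
lemma integral_exp_mul_pdfPI (hζ : 0 < ζ) (hPA : 0 < PA) {s : ℝ} (hs : 0 ≤ s) :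
    ∫ ρ in Ioi 0, Real.exp (-(s * ρ)) * pdfPI ζ PA ρ
      = Real.exp (-(2 * levyScale ζ PA * √s)) := by
  rw [integral_Ioi_of_hasDerivAt_of_nonneg
    (continuousWithinAt_levyPrimitive (levyScale_pos hζ hPA) √s)
    (fun _ hρ => hasDerivAt_levyPrimitive_pdfPI hPA.le hs hρ)
    (fun _ hρ => mul_nonneg (Real.exp_pos _).le (pdfPI_nonneg hζ.le hρ))
    (tendsto_levyPrimitive_atTop _ (Real.sqrt_nonneg s))]
  simp [levyPrimitive]

lemma integrableOn_pdfPI (hζ : 0 < ζ) (hPA : 0 < PA) : IntegrableOn (pdfPI ζ PA) (Ioi 0) := by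
  simpa using integrableOn_exp_mul_pdfPI hζ hPA le_rfl

/-- The tail of the law is given by the complementary error function. -/
lemma integral_Ioi_pdfPI (hζ : 0 < ζ) (hPA : 0 < PA) {ρ : ℝ} (hρ : 0 < ρ) :
    ∫ x in Ioi ρ, pdfPI ζ PA x = 1 - cdfPI ζ PA ρ := by
  have h : ∀ x ∈ Ici ρ, HasDerivAt (levyPrimitive (levyScale ζ PA) 0) (pdfPI ζ PA x) x :=
    fun x hx => by
      have := hasDerivAt_levyPrimitive_pdfPI (ζ := ζ) hPA.le le_rfl (hρ.trans_le hx)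
      simpa using this
  rw [integral_Ioi_of_hasDerivAt_of_nonneg' h
    (fun x hx => pdfPI_nonneg hζ.le (hρ.trans hx))
    (tendsto_levyPrimitive_atTop _ le_rfl), levyPrimitive_zero_right _ hρ, cdfPI_eq]
  simp

/-- The Lévy law of the incident power. -/
def lawPI (ζ PA : ℝ) : Measure ℝ :=
  (volume.restrict (Ioi (0 : ℝ))).withDensity fun ρ => ENNReal.ofReal (pdfPI ζ PA ρ)

lemma lintegral_lawPI (hζ : 0 ≤ ζ) {F : ℝ → ℝ} (hF : Measurable F) :
    ∫⁻ ρ, ENNReal.ofReal (F ρ) ∂(lawPI ζ PA)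
      = ∫⁻ ρ in Ioi 0, ENNReal.ofReal (F ρ * pdfPI ζ PA ρ) := by
  rw [lawPI, lintegral_withDensity_eq_lintegral_mul _ (measurable_pdfPI ζ PA).ennreal_ofReal
    hF.ennreal_ofReal]
  refine setLIntegral_congr_fun measurableSet_Ioi fun ρ hρ => ?_
  rw [Pi.mul_apply, mul_comm, ENNReal.ofReal_mul' (pdfPI_nonneg hζ hρ)]

/-- The Laplace transform of the law. -/
lemma lintegral_exp_lawPI (hζ : 0 < ζ) (hPA : 0 < PA) {s : ℝ} (hs : 0 ≤ s) :
    ∫⁻ ρ, ENNReal.ofReal (Real.exp (-(s * ρ))) ∂(lawPI ζ PA)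
      = ENNReal.ofReal (Real.exp (-(2 * levyScale ζ PA * √s))) := by
  rw [lintegral_lawPI hζ.le (by fun_prop), ← integral_exp_mul_pdfPI hζ hPA hs,
    ofReal_integral_eq_lintegral_ofReal (integrableOn_exp_mul_pdfPI hζ hPA hs)]
  filter_upwards [ae_restrict_mem measurableSet_Ioi] with ρ hρ
  exact mul_nonneg (Real.exp_pos _).le (pdfPI_nonneg hζ.le hρ)

lemma isProbabilityMeasure_lawPI (hζ : 0 < ζ) (hPA : 0 < PA) :
    IsProbabilityMeasure (lawPI ζ PA) := ⟨by
  have := lintegral_exp_lawPI hζ hPA le_rfl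
  simpa using this⟩

end Law

/-! ### Uniqueness -/

/-- On `[0, 1]` the exponential series is dominated by `∑ |t| ^ n / n!`, so it integrates term by
term and only moments remain. -/
lemma hasSum_charFun_of_mem_Icc {μ : Measure ℝ} [IsProbabilityMeasure μ]
    (hμ : ∀ᵐ x ∂μ, x ∈ Icc (0 : ℝ) 1) (t : ℝ) :
    HasSum (fun n : ℕ => (t * Complex.I) ^ n / n.factorial * ((∫ x, x ^ n ∂μ : ℝ) : ℂ))
      (charFun μ t) := by
  set F : ℕ → ℝ → ℂ := fun n x => (t * Complex.I) ^ n / n.factorial * ((x ^ n : ℝ) : ℂ) with hF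
  have hb : ∀ n, ∀ᵐ x ∂μ, ‖F n x‖ ≤ |t| ^ n / n.factorial := fun n => by
    filter_upwards [hμ] with x hx
    have h1 : |x ^ n| ≤ 1 := by
      rw [abs_of_nonneg (pow_nonneg hx.1 n)]
      exact pow_le_one₀ hx.1 hx.2
    have h2 : 0 ≤ |t| ^ n / n.factorial := by positivity
    simp only [hF, norm_mul, norm_div, norm_pow, Complex.norm_real, Complex.norm_I, mul_one,
      Real.norm_eq_abs, Complex.norm_natCast]
    rw [← abs_pow x]
    exact mul_le_of_le_one_right h2 h1
  have hFm : ∀ n, AEStronglyMeasurable (F n) μ := fun n => by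
    refine Measurable.aestronglyMeasurable ?_
    fun_prop
  have hFi : ∀ n, Integrable (F n) μ := fun n => Integrable.of_bound (hFm n) _ (hb n)
  have hs : Summable fun n => ∫ x, ‖F n x‖ ∂μ := by
    refine Summable.of_nonneg_of_le (fun n => integral_nonneg fun x => norm_nonneg _) (fun n => ?_)
      (Real.summable_pow_div_factorial |t|)
    have := integral_mono_ae (hFi n).norm (integrable_const _) (hb n)
    simpa using this
  have h := hasSum_integral_of_summable_integral_norm hFi hs
  have h1 : ∀ n, ∫ x, F n x ∂μ
      = (t * Complex.I) ^ n / n.factorial * ((∫ x, x ^ n ∂μ : ℝ) : ℂ) := fun n => by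
    simp only [hF]
    rw [integral_const_mul, integral_complex_ofReal]
  have h2 : ∫ x, ∑' n, F n x ∂μ = charFun μ t := by
    rw [charFun_apply_real]
    refine integral_congr_ae (ae_of_all _ fun x => ?_)
    have := (NormedSpace.expSeries_div_hasSum_exp (𝔸 := ℂ) (t * x * Complex.I)).tsum_eq
    rw [← Complex.exp_eq_exp_ℂ] at this
    simp only
    rw [← this]
    refine tsum_congr fun n => ?_
    simp only [hF, Complex.ofReal_pow, mul_pow]
    ring
  simp_rw [h1] at h
  rwa [h2] at h

/-- A probability measure on the unit interval is determined by its moments. -/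
theorem ext_of_integral_pow_of_mem_Icc {μ ν : Measure ℝ} [IsProbabilityMeasure μ]
    [IsProbabilityMeasure ν] (hμ : ∀ᵐ x ∂μ, x ∈ Icc (0 : ℝ) 1) (hν : ∀ᵐ x ∂ν, x ∈ Icc (0 : ℝ) 1)
    (h : ∀ n : ℕ, ∫ x, x ^ n ∂μ = ∫ x, x ^ n ∂ν) : μ = ν := by
  refine Measure.ext_of_charFun (funext fun t => ?_)
  have h1 := hasSum_charFun_of_mem_Icc hμ t
  simp_rw [h] at h1
  exact h1.unique (hasSum_charFun_of_mem_Icc hν t)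

lemma ae_lawPI_pos (ζ PA : ℝ) : ∀ᵐ ρ ∂(lawPI ζ PA), 0 < ρ :=
  (withDensity_absolutelyContinuous _ _).ae_le (ae_restrict_mem measurableSet_Ioi)

lemma negExp_eq_ofReal {x : ℝ≥0∞} (hx : x ≠ ∞) :
    negExp x = ENNReal.ofReal (Real.exp (-x.toReal)) := by
  rw [← negExp_ofReal ENNReal.toReal_nonneg, ENNReal.ofReal_toReal hx]

/-- The Lévy law is characterized by the values of its Laplace transform at the integers. -/
theorem hasLaw_toReal_of_laplace {Ω : Type*} [MeasurableSpace Ω] {Pr : Measure Ω}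
    [IsProbabilityMeasure Pr] {ζ PA : ℝ} (hζ : 0 < ζ) (hPA : 0 < PA) {S : Ω → ℝ≥0∞}
    (hS : Measurable S)
    (h : ∀ n : ℕ, ∫⁻ w, negExp (S w * n) ∂Pr
      = ENNReal.ofReal (Real.exp (-(2 * levyScale ζ PA * √n)))) :
    (∀ᵐ w ∂Pr, S w ≠ ∞) ∧ HasLaw (fun w => (S w).toReal) (lawPI ζ PA) Pr := by
  have := isProbabilityMeasure_lawPI hζ hPA
  -- The `n`-th moment of `Y = exp (-S)` is the transform of `S` at `n`, and `Y = 0` exactly where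
  -- `S = ∞`.
  set Y : Ω → ℝ := fun w => (negExp (S w)).toReal with hY
  have hYm : Measurable Y := (measurable_negExp.comp hS).ennreal_toReal
  have hEm : Measurable fun ρ : ℝ => Real.exp (-ρ) := by fun_prop
  have i1 := Measure.isProbabilityMeasure_map (μ := Pr) hYm.aemeasurable
  have i2 := Measure.isProbabilityMeasure_map (μ := lawPI ζ PA) hEm.aemeasurable
  have hY01 : ∀ w, Y w ∈ Icc (0 : ℝ) 1 := fun w =>
    ⟨ENNReal.toReal_nonneg, ENNReal.toReal_le_of_le_ofReal zero_le_one
      (by simpa using negExp_le_one (S w))⟩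
  have hmap : Pr.map Y = (lawPI ζ PA).map fun ρ => Real.exp (-ρ) := by
    refine ext_of_integral_pow_of_mem_Icc ?_ ?_ fun n => ?_
    · exact (ae_map_iff hYm.aemeasurable measurableSet_Icc).2 (ae_of_all _ hY01)
    · refine (ae_map_iff hEm.aemeasurable measurableSet_Icc).2 ?_
      filter_upwards [ae_lawPI_pos ζ PA] with ρ hρ
      exact ⟨(Real.exp_pos _).le, Real.exp_le_one_iff.2 (by linarith)⟩
    · rw [integral_map hYm.aemeasurable (by fun_prop), integral_map hEm.aemeasurable (by fun_prop),
        integral_eq_lintegral_of_nonneg_ae (ae_of_all _ fun w => pow_nonneg (hY01 w).1 n)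
          (hYm.pow_const n).aestronglyMeasurable,
        integral_eq_lintegral_of_nonneg_ae (ae_of_all _ fun ρ => pow_nonneg (Real.exp_pos _).le n)
          (hEm.pow_const n).aestronglyMeasurable]
      congr 1
      have h1 : ∀ w, ENNReal.ofReal (Y w ^ n) = negExp (S w * n) := fun w => by
        rw [negExp_mul_natCast, ENNReal.ofReal_pow (hY01 w).1,
          ENNReal.ofReal_toReal (negExp_ne_top _)]
      have h2 : ∀ ρ : ℝ, ENNReal.ofReal (Real.exp (-ρ) ^ n)
          = ENNReal.ofReal (Real.exp (-(n * ρ))) := fun ρ => by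
        rw [← Real.exp_nat_mul, mul_neg]
      simp_rw [h1, h2]
      rw [h n, lintegral_exp_lawPI hζ hPA n.cast_nonneg]
  have hpos : ∀ᵐ w ∂Pr, 0 < Y w := by
    have : ∀ᵐ y ∂(Pr.map Y), 0 < y := by
      rw [hmap]
      exact (ae_map_iff hEm.aemeasurable measurableSet_Ioi).2
        (ae_of_all _ fun ρ => Real.exp_pos _)
    exact (ae_map_iff hYm.aemeasurable measurableSet_Ioi).1 this
  have hfin : ∀ᵐ w ∂Pr, S w ≠ ∞ := by
    filter_upwards [hpos] with w hw hS
    simp [hY, hS] at hw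
  refine ⟨hfin, ?_⟩
  have hlog : HasLaw (fun w => -Real.log (Y w)) (lawPI ζ PA) Pr := by
    refine ⟨by fun_prop, ?_⟩
    have hm : Measurable fun y : ℝ => -Real.log y := by fun_prop
    have h1 : Pr.map (fun w => -Real.log (Y w)) = (Pr.map Y).map fun y => -Real.log y :=
      (Measure.map_map hm hYm).symm
    rw [h1, hmap, Measure.map_map hm hEm]
    have h2 : ((fun y => -Real.log y) ∘ fun ρ : ℝ => Real.exp (-ρ)) = id := by
      ext ρ
      simp
    rw [h2, Measure.map_id]
  refine hlog.congr ?_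
  filter_upwards [hfin] with w hw
  simp only [hY]
  rw [negExp_eq_ofReal hw, ENNReal.toReal_ofReal (Real.exp_pos _).le, Real.log_exp, neg_neg]

/-! ### The law of the incident power -/

/-- The path gain of exponent `4`, times the transmit power. -/
def pathGain (PA : ℝ) (xS x : Plane) : ℝ := PA * ‖x - xS‖ ^ (-4 : ℝ)

lemma pathGain_nonneg {PA : ℝ} (hPA : 0 ≤ PA) (xS x : Plane) : 0 ≤ pathGain PA xS x := by
  unfold pathGain
  positivity

lemma measurable_pathGain (PA : ℝ) (xS : Plane) : Measurable (pathGain PA xS) := by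
  unfold pathGain
  fun_prop

/-- The incident power as a sum in `[0, ∞]`, as a function of locations, states and gains. -/
def totalPower (PA : ℝ) (xS : Plane) (p : ((ℕ → Plane) × (ℕ → Bool)) × (ℕ → ℝ)) : ℝ≥0∞ :=
  ∑' a, contribution (pathGain PA xS (p.1.1 a)) (p.1.2 a) (p.2 a)

lemma measurable_totalPower (PA : ℝ) (xS : Plane) : Measurable (totalPower PA xS) := by
  refine Measurable.tsum fun a => measurable_contribution ?_ (by fun_prop) (by fun_prop)
  exact (measurable_pathGain PA xS).comp (by fun_prop)

lemma contribution_ne_top (r : ℝ) (b : Bool) (y : ℝ) : contribution r b y ≠ ∞ := by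
  unfold contribution
  split_ifs
  · exact ENNReal.mul_ne_top ENNReal.ofReal_ne_top ENNReal.ofReal_ne_top
  · simp

lemma contribution_mul_natCast (r : ℝ) (b : Bool) (y : ℝ) (n : ℕ) :
    contribution r b y * n = contribution (n * r) b y := by
  unfold contribution
  split_ifs
  · rw [ENNReal.ofReal_mul n.cast_nonneg, ENNReal.ofReal_natCast]
    ring
  · simp

variable {Ω : Type*} {X : ℕ → Ω → Plane} {c : ℕ → Ω → Bool} {h : ℕ → Ω → ℝ} {g : Ω → ℝ}
  {ζ l lam PA : ℝ}

/-- The random locations, states and ambient gains. -/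
def environment (X : ℕ → Ω → Plane) (c : ℕ → Ω → Bool) (h : ℕ → Ω → ℝ) (w : Ω) :
    ((ℕ → Plane) × (ℕ → Bool)) × (ℕ → ℝ) :=
  ((fun a => X a w, fun a => c a w), fun a => h a w)

/-- Negative gains are truncated by `ENNReal.ofReal`, hence the sign condition, which holds almost
surely. -/
lemma toReal_contribution_pathGain (hPA : 0 ≤ PA) (xS : Plane) {w : Ω} {a : ℕ} (hw : 0 ≤ h a w) :
    (contribution (pathGain PA xS (X a w)) (c a w) (h a w)).toReal
      = PA * {a | c a w = true}.indicator (receivedGain 4 xS X h w) a := by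
  by_cases hc : c a w = true
  · rw [indicator_of_mem (show a ∈ {a | c a w = true} from hc), contribution, if_pos hc,
      ENNReal.toReal_mul, ENNReal.toReal_ofReal hw,
      ENNReal.toReal_ofReal (pathGain_nonneg hPA xS _), receivedGain, pathGain]
    ring
  · rw [indicator_of_notMem (show a ∉ {a | c a w = true} from hc), contribution, if_neg hc]
    simp

lemma summable_of_totalPower_ne_top (hPA : 0 < PA) (xS : Plane) {w : Ω} (hw : ∀ a, 0 ≤ h a w)
    (hfin : totalPower PA xS (environment X c h w) ≠ ∞) :
    Summable (fun a : {a : ℕ // c a w = true} => receivedGain 4 xS X h w a) := by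
  refine (summable_subtype_iff_indicator (f := receivedGain 4 xS X h w)
    (s := {a | c a w = true})).2 ?_
  have := ENNReal.summable_toReal hfin
  refine (summable_mul_left_iff hPA.ne').1 (this.congr fun a => ?_)
  exact toReal_contribution_pathGain hPA.le xS (hw a)

/-- Finiteness is not needed: a divergent real series has `tsum` equal to `0`, as does `∞` under
`toReal`. -/
lemma incidentPower_eq (hPA : 0 ≤ PA) (xS : Plane) {w : Ω} (hw : ∀ a, 0 ≤ h a w) :
    incidentPower PA 4 xS X c h w = (totalPower PA xS (environment X c h w)).toReal := by
  rw [totalPower, ENNReal.tsum_toReal_eq fun a => contribution_ne_top _ _ _, incidentPower]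
  have := tsum_subtype {a | c a w = true} (receivedGain 4 xS X h w)
  refine (congrArg (PA * ·) this).trans ?_
  rw [← tsum_mul_left]
  exact tsum_congr fun a => (toReal_contribution_pathGain hPA xS (hw a)).symm

/-- The event that backscattering is selected by the SNR, in terms of the incident power and of
the gain of the link. -/
lemma lt_snrB_and_lt_harvestB_iff {β ϱ δ σ ρB d τB : ℝ} (hβ : 0 < β) (hϱ : 0 < ϱ) (hϱ1 : ϱ < 1)
    (hδ : 0 < δ) (hσ : 0 < σ) (hρB : 0 < ρB) (hd : 0 < d) (PI g : Ω → ℝ) (w : Ω) :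
    (τB < snrB δ β ϱ ρB d 4 σ PI g w ∧ ρB < harvestB β ϱ PI w) ↔
      (ρB / (β * ϱ) < PI w ∧ τB * d ^ (4 : ℝ) * σ ^ 2 / (δ * PI w * (1 - ϱ)) < g w) := by
  have h1 : ρB < harvestB β ϱ PI w ↔ ρB / (β * ϱ) < PI w := by
    rw [harvestB, div_lt_iff₀' (by positivity)]
  rw [and_comm, h1]
  refine and_congr_right fun h2 => ?_
  have hP : 0 < PI w := lt_trans (by positivity) h2
  have h3 : 0 < 1 - ϱ := by linarith
  have hd4 : 0 < d ^ (4 : ℝ) := by positivity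
  rw [snrB, backscatterPower, if_pos (h1.2 h2), Real.rpow_neg hd.le,
    lt_div_iff₀ (by positivity), div_lt_iff₀ (by positivity), ← div_eq_mul_inv,
    lt_div_iff₀ hd4]
  constructor <;> intro h <;> nlinarith [h]

variable [MeasurableSpace Ω] {Pr : Measure Ω}

namespace IsNetwork

lemma measurable_environment (hnet : IsNetwork X c h g ζ l lam Pr) :
    Measurable (environment X c h) :=
  ((measurable_pi_lambda _ hnet.poisson.measurable).prodMk
    (measurable_pi_lambda _ hnet.measurable_c)).prodMk (measurable_pi_lambda _ hnet.measurable_h)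

lemma ae_gain_nonneg (hnet : IsNetwork X c h g ζ l lam Pr) : ∀ᵐ w ∂Pr, ∀ a, 0 ≤ h a w := by
  refine ae_all_iff.2 fun a => ?_
  have h0 : ∀ᵐ y ∂(expMeasure 1), 0 ≤ y := by
    have hm : Measurable (exponentialPDF 1) := (measurable_exponentialPDFReal 1).ennreal_ofReal
    have hd : expMeasure 1 = volume.withDensity (exponentialPDF 1) := rfl
    rw [hd, ae_withDensity_iff hm]
    refine ae_of_all _ fun y hy => ?_
    by_contra hlt
    exact hy (exponentialPDF_of_neg (not_le.1 hlt))
  exact ((hnet.law_h a).ae_iff measurableSet_Ici.mem).2 h0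

variable [IsProbabilityMeasure Pr]

lemma indepFun_environment (hnet : IsNetwork X c h g ζ l lam Pr) :
    IndepFun (environment X c h) g Pr := by
  have mX : Measurable fun w a => X a w := measurable_pi_lambda _ hnet.poisson.measurable
  have mc : Measurable fun w a => c a w := measurable_pi_lambda _ hnet.measurable_c
  have mh : Measurable fun w a => h a w := measurable_pi_lambda _ hnet.measurable_h
  exact indepFun_prodMk_left_of_indepFun (mX.prodMk mc) mh hnet.measurable_g
    (indepFun_prodMk_left_of_indepFun mX mc (mh.prodMk hnet.measurable_g) hnet.indep_X
      hnet.indep_c_hg) hnet.indep_h_g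

/-- The argument `n` rescales the path gain, so the plane integral is taken at `t = n * PA`, and `ζ
l π ^ 2 √(n PA) / 2 = 2 k √n`. -/
lemma lintegral_negExp_totalPower (hnet : IsNetwork X c h g ζ l lam Pr) (hζ : 0 ≤ ζ) (hl : 0 ≤ l)
    (hl1 : l ≤ 1) (hPA : 0 ≤ PA) (xS : Plane) (n : ℕ) :
    ∫⁻ w, negExp (totalPower PA xS (environment X c h w) * n) ∂Pr
      = ENNReal.ofReal (Real.exp (-(2 * levyScale (l * ζ) PA * √n))) := by
  have h1 : ∀ w, totalPower PA xS (environment X c h w) * n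
      = ∑' a, contribution (n * pathGain PA xS (X a w)) (c a w) (h a w) := fun w => by
    rw [totalPower, ← ENNReal.tsum_mul_right]
    exact tsum_congr fun a => contribution_mul_natCast _ _ _ n
  simp_rw [h1]
  rw [hnet.lintegral_negExp_tsum_contribution hl hl1
    (ℓ := fun x => n * pathGain PA xS x) ((measurable_pathGain PA xS).const_mul _)
    (fun x => mul_nonneg n.cast_nonneg (pathGain_nonneg hPA xS x))]
  have h2 := lintegral_pathGain hl (mul_nonneg n.cast_nonneg hPA : 0 ≤ (n : ℝ) * PA) xS
  simp only [pathGain, ← mul_assoc] at h2 ⊢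
  rw [h2, ← ENNReal.ofReal_mul hζ, negExp_ofReal (by positivity), Real.sqrt_mul n.cast_nonneg]
  unfold levyScale
  congr 3
  ring

lemma totalPower_ae (hnet : IsNetwork X c h g ζ l lam Pr) (hζ : 0 < ζ) (hl : 0 < l)
    (hl1 : l ≤ 1) (hPA : 0 < PA) (xS : Plane) :
    (∀ᵐ w ∂Pr, totalPower PA xS (environment X c h w) ≠ ∞) ∧
    HasLaw (fun w => (totalPower PA xS (environment X c h w)).toReal) (lawPI (l * ζ) PA) Pr :=
  hasLaw_toReal_of_laplace (mul_pos hl hζ) hPA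
    ((measurable_totalPower PA xS).comp hnet.measurable_environment)
    fun n => hnet.lintegral_negExp_totalPower hζ.le hl.le hl1 hPA.le xS n

end IsNetwork

/-! ### Tails -/

variable [IsProbabilityMeasure Pr]

lemma setLIntegral_Ioi_lawPI (hζ : 0 ≤ ζ) {F : ℝ → ℝ} (hF : Measurable F) (hF0 : ∀ ρ, 0 ≤ F ρ)
    {r : ℝ} (hr : 0 ≤ r) (hint : IntegrableOn (fun ρ => F ρ * pdfPI ζ PA ρ) (Ioi r)) :
    ∫⁻ ρ in Ioi r, ENNReal.ofReal (F ρ) ∂(lawPI ζ PA)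
      = ENNReal.ofReal (∫ ρ in Ioi r, F ρ * pdfPI ζ PA ρ) := by
  have hsub : Ioi r ⊆ Ioi (0 : ℝ) := Ioi_subset_Ioi hr
  rw [lawPI, restrict_withDensity measurableSet_Ioi, Measure.restrict_restrict measurableSet_Ioi,
    inter_eq_left.2 hsub, lintegral_withDensity_eq_lintegral_mul _
      (measurable_pdfPI ζ PA).ennreal_ofReal hF.ennreal_ofReal,
    ofReal_integral_eq_lintegral_ofReal hint]
  · refine setLIntegral_congr_fun measurableSet_Ioi fun ρ hρ => ?_
    rw [Pi.mul_apply, mul_comm, ENNReal.ofReal_mul (hF0 ρ)]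
  · filter_upwards [ae_restrict_mem measurableSet_Ioi] with ρ hρ
    exact mul_nonneg (hF0 ρ) (pdfPI_nonneg hζ (hsub hρ))

lemma lawPI_real_Iic (hζ : 0 < ζ) (hPA : 0 < PA) {r : ℝ} (hr : 0 < r) :
    (lawPI ζ PA).real (Iic r) = cdfPI ζ PA r := by
  have := isProbabilityMeasure_lawPI hζ hPA
  have hint := (integrableOn_pdfPI hζ hPA).mono_set (Ioi_subset_Ioi hr.le)
  have h1 := setLIntegral_Ioi_lawPI (PA := PA) hζ.le (F := fun _ => 1) measurable_const
    (fun _ => zero_le_one) hr.le (by simpa using hint)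
  simp only [one_mul, integral_Ioi_pdfPI hζ hPA hr, ENNReal.ofReal_one, setLIntegral_one] at h1
  have h2 : 0 ≤ 1 - cdfPI ζ PA r := by
    rw [← integral_Ioi_pdfPI hζ hPA hr]
    exact setIntegral_nonneg measurableSet_Ioi fun ρ hρ => pdfPI_nonneg hζ.le (hr.trans hρ)
  have h3 : (lawPI ζ PA).real (Ioi r) = 1 - cdfPI ζ PA r := by
    rw [measureReal_def, h1, ENNReal.toReal_ofReal h2]
  rw [← compl_Ioi, probReal_compl_eq_one_sub measurableSet_Ioi, h3]
  ring

lemma expMeasure_Ioi {r x : ℝ} (hr : 0 < r) (hx : 0 ≤ x) :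
    expMeasure r (Ioi x) = ENNReal.ofReal (Real.exp (-(r * x))) := by
  have := isProbabilityMeasure_expMeasure hr
  have h1 : (expMeasure r).real (Iic x) = 1 - Real.exp (-(r * x)) := by
    rw [← cdf_eq_real, cdf_expMeasure_eq hr, if_pos hx]
  rw [← compl_Iic, ← ofReal_measureReal, probReal_compl_eq_one_sub measurableSet_Iic, h1]
  congr 1
  ring

/-- The joint tail of a variable of Lévy law and an independent exponential variable, the
threshold for the latter being a function of the former. -/
lemma measure_lt_and_lt {Q : Ω → ℝ} (hQ : Measurable Q) (hg : Measurable g)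
    (hQl : HasLaw Q (lawPI ζ PA) Pr) (hgl : HasLaw g (expMeasure lam) Pr) (hlam : 0 < lam)
    (hQg : IndepFun Q g Pr) (hζ : 0 ≤ ζ) {T : ℝ → ℝ} (hT : Measurable T) (r : ℝ) (hr : 0 ≤ r)
    (hT0 : ∀ ρ, r < ρ → 0 ≤ T ρ)
    (hint : IntegrableOn (fun ρ => Real.exp (-(lam * T ρ)) * pdfPI ζ PA ρ) (Ioi r)) :
    Pr {w | r < Q w ∧ T (Q w) < g w}
      = ENNReal.ofReal (∫ ρ in Ioi r, Real.exp (-(lam * T ρ)) * pdfPI ζ PA ρ) := by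
  set A : Set (ℝ × ℝ) := {p | r < p.1 ∧ T p.1 < p.2} with hA
  have hAm : MeasurableSet A := (measurableSet_lt measurable_const measurable_fst).inter
    (measurableSet_lt (hT.comp measurable_fst) measurable_snd)
  have h1 : Pr {w | r < Q w ∧ T (Q w) < g w}
      = ∫⁻ w, A.indicator 1 (Q w, g w) ∂Pr := by
    exact (lintegral_indicator_one ((hQ.prodMk hg) hAm)).symm
  have h2 : ∀ ρ, ∫⁻ w', A.indicator 1 (ρ, g w') ∂Pr
      = (Ioi r).indicator (fun ρ => ENNReal.ofReal (Real.exp (-(lam * T ρ)))) ρ := fun ρ => by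
    by_cases hρ : r < ρ
    · rw [indicator_of_mem (show ρ ∈ Ioi r from hρ), ← expMeasure_Ioi hlam (hT0 ρ hρ),
        ← hgl.map_eq, Measure.map_apply hg measurableSet_Ioi,
        ← lintegral_indicator_one (hg measurableSet_Ioi)]
      refine lintegral_congr fun w' => ?_
      simp [indicator, hA, hρ]
    · rw [indicator_of_notMem (show ρ ∉ Ioi r from hρ)]
      simp [hA, hρ]
  rw [h1, lintegral_comp_of_indepFun (G := fun x y => A.indicator (1 : ℝ × ℝ → ℝ≥0∞) (x, y)) hQ hg
    hQg (measurable_one.indicator hAm)]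
  simp_rw [h2]
  rw [hQl.lintegral_comp (f := (Ioi r).indicator fun ρ =>
      ENNReal.ofReal (Real.exp (-(lam * T ρ))))
      ((Measurable.indicator (by fun_prop) measurableSet_Ioi).aemeasurable),
    lintegral_indicator measurableSet_Ioi,
    setLIntegral_Ioi_lawPI hζ (by fun_prop) (fun _ => (Real.exp_pos _).le) hr hint]

end

end HybridD2D

/-! ### The outage probabilities -/

theorem corollary1 {Ω : Type*} [MeasurableSpace Ω] (Pr : Measure Ω) [IsProbabilityMeasure Pr]
    (X : ℕ → Ω → HybridD2D.Plane) (c : ℕ → Ω → Bool) (h : ℕ → Ω → ℝ) (g : Ω → ℝ)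
    (xS xD : HybridD2D.Plane) (ζA lA lam PA β ϱ ω δ σ ρB ρH τB : ℝ)
    (hζA : 0 < ζA) (hlA : 0 < lA) (hlA1 : lA ≤ 1) (hlam : 0 < lam) (hPA : 0 < PA)
    (hβ : 0 < β) (hβ1 : β ≤ 1) (hϱ : 0 < ϱ) (hϱ1 : ϱ < 1) (hω : 0 < ω) (hω1 : ω < 1)
    (hδ : 0 < δ) (hδ1 : δ ≤ 1) (hσ : 0 < σ) (hρB : 0 < ρB) (hρH : 0 < ρH) (hτB : 0 ≤ τB)
    (hxSD : xS ≠ xD)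
    (hnet : HybridD2D.IsNetwork X c h g ζA lA lam Pr)
    (PI : Ω → ℝ) (hPI : PI = HybridD2D.incidentPower PA 4 xS X c h) :
    -- the incident power is almost surely a convergent series
    (∀ᵐ w ∂Pr, Summable
      (fun a : {a : ℕ // c a w = true} => HybridD2D.receivedGain 4 xS X h w a)) ∧
    -- its law has the explicit density on the positive half-line
    HasLaw PI ((volume.restrict (Ioi (0 : ℝ))).withDensity
      (fun ρ => ENNReal.ofReal (HybridD2D.pdfPI (lA * ζA) PA ρ))) Pr ∧
    -- its distribution function
    (∀ ρ : ℝ, 0 < ρ → Pr.real {w | PI w ≤ ρ} = HybridD2D.cdfPI (lA * ζA) PA ρ) ∧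
    -- energy outage probability under the power threshold-based protocol
    HybridD2D.energyOutage (HybridD2D.selectPTP ω β ρH PI Pr) ω β ϱ ρB ρH PI Pr =
      HybridD2D.cdfPI (lA * ζA) PA (ρH / (ω * β)) *
        (HybridD2D.cdfPI (lA * ζA) PA (ρB / (β * ϱ))
          - HybridD2D.cdfPI (lA * ζA) PA (ρH / (ω * β)) + 1) ∧
    -- energy outage probability under the SNR threshold-based protocol
    IntegrableOn (fun ρ => Real.exp (-(lam * τB * dist xS xD ^ (4 : ℝ) * σ ^ 2 /
      (δ * ρ * (1 - ϱ)))) * HybridD2D.pdfPI (lA * ζA) PA ρ) (Ioi (ρB / (β * ϱ))) ∧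
    HybridD2D.energyOutage
        (HybridD2D.selectSTP δ β ϱ ρB (dist xS xD) 4 σ τB PI g Pr) ω β ϱ ρB ρH PI Pr =
      (∫ ρ in Ioi (ρB / (β * ϱ)), Real.exp (-(lam * τB * dist xS xD ^ (4 : ℝ) * σ ^ 2 /
          (δ * ρ * (1 - ϱ)))) * HybridD2D.pdfPI (lA * ζA) PA ρ) *
        (HybridD2D.cdfPI (lA * ζA) PA (ρB / (β * ϱ))
          - HybridD2D.cdfPI (lA * ζA) PA (ρH / (ω * β)))
      + HybridD2D.cdfPI (lA * ζA) PA (ρH / (ω * β)) := by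
  have hζ : 0 < lA * ζA := mul_pos hlA hζA
  have hd : 0 < dist xS xD := dist_pos.2 hxSD
  have hϱ' : 0 < 1 - ϱ := by linarith
  have hrB : 0 < ρB / (β * ϱ) := by positivity
  have hrH : 0 < ρH / (ω * β) := by positivity
  -- A version of `PI` that is a measurable function of the environment, hence independent of `g`;
  -- the two agree wherever all ambient gains are nonnegative.
  let Q : Ω → ℝ := fun w =>
    (HybridD2D.totalPower PA xS (HybridD2D.environment X c h w)).toReal
  obtain ⟨hfin, hQl⟩ := hnet.totalPower_ae hζA hlA hlA1 hPA xS
  have hmφ := (HybridD2D.measurable_totalPower PA xS).ennreal_toReal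
  have hQm : Measurable Q := hmφ.comp hnet.measurable_environment
  have hQg : IndepFun Q g Pr := hnet.indepFun_environment.comp hmφ measurable_id
  have hPQ : PI =ᵐ[Pr] Q := by
    filter_upwards [hnet.ae_gain_nonneg] with w hw
    rw [hPI]
    exact HybridD2D.incidentPower_eq hPA.le xS hw
  have hlaw : HasLaw PI (HybridD2D.lawPI (lA * ζA) PA) Pr := hQl.congr hPQ
  have hcdf : ∀ ρ : ℝ, 0 < ρ → Pr.real {w | PI w ≤ ρ} = HybridD2D.cdfPI (lA * ζA) PA ρ :=
    fun ρ hρ => by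
      rw [← HybridD2D.lawPI_real_Iic hζ hPA hρ]
      exact hlaw.measureReal_eq (p := fun x => x ≤ ρ) measurableSet_Iic
  have hB : Pr.real {w | HybridD2D.harvestB β ϱ PI w ≤ ρB}
      = HybridD2D.cdfPI (lA * ζA) PA (ρB / (β * ϱ)) := by
    rw [← hcdf _ hrB]
    congr 1
    ext w
    simp only [mem_ofPred_eq, HybridD2D.harvestB]
    rw [le_div_iff₀' (by positivity)]
  have hH : Pr.real {w | HybridD2D.harvestH ω β PI w ≤ ρH}
      = HybridD2D.cdfPI (lA * ζA) PA (ρH / (ω * β)) := by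
    rw [← hcdf _ hrH]
    congr 1
    ext w
    simp only [mem_ofPred_eq, HybridD2D.harvestH]
    rw [le_div_iff₀' (by positivity)]
  have hexp : ∀ ρ, lam * τB * dist xS xD ^ (4 : ℝ) * σ ^ 2 / (δ * ρ * (1 - ϱ))
      = lam * (τB * dist xS xD ^ (4 : ℝ) * σ ^ 2 / (δ * ρ * (1 - ϱ))) := fun ρ => by ring
  have hT0 : ∀ ρ, ρB / (β * ϱ) < ρ →
      0 ≤ τB * dist xS xD ^ (4 : ℝ) * σ ^ 2 / (δ * ρ * (1 - ϱ)) := fun ρ hρ => by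
    have : 0 < ρ := hrB.trans hρ
    positivity
  have hint : IntegrableOn (fun ρ => Real.exp (-(lam * τB * dist xS xD ^ (4 : ℝ) * σ ^ 2 /
      (δ * ρ * (1 - ϱ)))) * HybridD2D.pdfPI (lA * ζA) PA ρ) (Ioi (ρB / (β * ϱ))) := by
    refine ((HybridD2D.integrableOn_pdfPI hζ hPA).mono_set (Ioi_subset_Ioi hrB.le)).bdd_mul
      (c := 1) (Measurable.aestronglyMeasurable (by fun_prop)) ?_
    filter_upwards [ae_restrict_mem measurableSet_Ioi] with ρ hρ
    rw [Real.norm_eq_abs, Real.abs_exp, Real.exp_le_one_iff, neg_nonpos, hexp]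
    exact mul_nonneg hlam.le (hT0 ρ hρ)
  have hsel : HybridD2D.selectSTP δ β ϱ ρB (dist xS xD) 4 σ τB PI g Pr
      = ∫ ρ in Ioi (ρB / (β * ϱ)), Real.exp (-(lam * τB * dist xS xD ^ (4 : ℝ) * σ ^ 2 /
          (δ * ρ * (1 - ϱ)))) * HybridD2D.pdfPI (lA * ζA) PA ρ := by
    simp_rw [hexp] at hint ⊢
    have hset := HybridD2D.measure_lt_and_lt hQm hnet.measurable_g hQl hnet.law_g hlam hQg hζ.le
      (T := fun ρ => τB * dist xS xD ^ (4 : ℝ) * σ ^ 2 / (δ * ρ * (1 - ϱ))) (by fun_prop)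
      _ hrB.le hT0 hint
    have hae : {w | τB < HybridD2D.snrB δ β ϱ ρB (dist xS xD) 4 σ PI g w ∧
        ρB < HybridD2D.harvestB β ϱ PI w} =ᵐ[Pr] {w | ρB / (β * ϱ) < Q w ∧
          τB * dist xS xD ^ (4 : ℝ) * σ ^ 2 / (δ * Q w * (1 - ϱ)) < g w} := by
      filter_upwards [hPQ] with w hw
      refine propext ((HybridD2D.lt_snrB_and_lt_harvestB_iff hβ hϱ hϱ1 hδ hσ hρB hd PI g w).trans
        ?_)
      rw [hw]
      rfl
    rw [HybridD2D.selectSTP, measureReal_congr hae, measureReal_def, hset, ENNReal.toReal_ofReal]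
    exact setIntegral_nonneg measurableSet_Ioi fun ρ hρ =>
      mul_nonneg (Real.exp_pos _).le (HybridD2D.pdfPI_nonneg hζ.le (hrB.trans hρ))
  refine ⟨?_, hlaw, hcdf, ?_, hint, ?_⟩
  · filter_upwards [hfin, hnet.ae_gain_nonneg] with w hw1 hw2
    exact HybridD2D.summable_of_totalPower_ne_top hPA xS hw2 hw1
  · rw [HybridD2D.energyOutage, HybridD2D.selectPTP, hB, hH]
    ring
  · rw [HybridD2D.energyOutage, hsel, hB, hH]
    ring
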